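/- Fix $u>0$, a positive integer $d$ and a positive semidefinite $d\times d$ matrix $L$. Let $h$ denote differential entropy (in nats, with $h=-\infty$ for distributions without a Lebesgue density), let $\gamma_K$ be the centered Gaussian measure on $\mathbb{R}^d$ with covariance matrix $K$, and let $*$ denote convolution. For a probability distribution $P_X$ on $\mathbb{R}^d$ with finite second moments put $$\Psi(P_X,L):=\sup_{P_Y:\ \mathrm{cov}(P_Y)\preceq L}\bigl\{u\,h(P_X*\gamma_{uI}*P_Y)+h(P_X)-(1+u)\,h(P_X*\gamma_{uI})\bigr\},$$ $$\Theta(P_X,L):=\frac u2\ln\bigl[(2\pi e)^d\det(\mathrm{cov}(P_X)+uI+L)\bigr]+h(P_X)-(1+u)\,h(P_X*\gamma_{uI}),\qquad \Phi(L):=\sup_{K\succeq0}\Theta(\gamma_K,L),$$ where the first supremum is over probability distributions $P_Y$ on $\mathbb{R}^d$ with finite second moments and covariance $\preceq L$, and the last one over positive semidefinite $d\times d$ matrices $K$. Suppose that $K$ is a maximizer in the definition of $\Phi(L)$ and that the top eigenvalue of $K$ is strictly smaller than $\frac{u}{(1+u)^{1/3}-1}$. Then there exists $\epsilon>0$ such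 that every probability distribution $P_X$ on $\mathbb{R}^d$ with $\int x\,dP_X(x)=0$ and $\|P_X-\gamma_K\|_{L^\infty(\gamma_K)}\le\epsilon$ satisfies $\Theta(P_X,L)\le\Phi(L)$, and consequently $\Psi(P_X,L)\le\Phi(L)$. Here $\|P_X-\gamma_K\|_{L^\infty(\gamma_K)}$ is the $\gamma_K$-essential supremum of $\bigl|\frac{dP_X}{d\gamma_K}-1\bigr|$, taken to be $\infty$ if $P_X$ is not absolutely continuous with respect to $\gamma_K$. -/

import Mathlib

open MeasureTheory ProbabilityTheory
open scoped ENNReal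

noncomputable section

/-- The differential entropy `h(P) = -∫ p ln p` (in nats) of a measure `P` on `ℝ^d` with Lebesgue
density `p`, as the integral of the positive part of `-p ln p` minus the integral of its negative
part, with the usual convention `h(P) = -∞` when `P` has no density. -/
def diffEntropy {d : ℕ} (P : Measure (EuclideanSpace ℝ (Fin d))) : EReal :=
  open Classical in
  if P ≪ volume then
    ((∫⁻ x, ENNReal.ofReal (Real.negMulLog (P.rnDeriv volume x).toReal) : ℝ≥0∞) : EReal) -
      ((∫⁻ x, ENNReal.ofReal (-Real.negMulLog (P.rnDeriv volume x).toReal) : ℝ≥0∞) : EReal)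
  else ⊥

/-- The covariance matrix of a distribution on `ℝ^d` (with finite second moments). -/
def covMat {d : ℕ} (P : Measure (EuclideanSpace ℝ (Fin d))) : Matrix (Fin d) (Fin d) ℝ :=
  Matrix.of fun i j => covariance (fun x => x i) (fun x => x j) P

/-- `γ_K`: the centered Gaussian measure on `ℝ^d` with covariance matrix `K`. -/
def gaussianCov {d : ℕ} (K : Matrix (Fin d) (Fin d) ℝ) : Measure (EuclideanSpace ℝ (Fin d)) :=
  multivariateGaussian 0 K

/-- `γ_{uI}`. -/
def gaussianIso (d : ℕ) (u : ℝ) : Measure (EuclideanSpace ℝ (Fin d)) :=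
  gaussianCov (u • (1 : Matrix (Fin d) (Fin d) ℝ))

/-- `Ψ(P, L) = sup { u h(P * γ_{uI} * Q) + h(P) - (1 + u) h(P * γ_{uI}) }`, over all probability
distributions `Q` on `ℝ^d` with finite second moments and `cov(Q) ≼ L`. -/
def Psi {d : ℕ} (u : ℝ) (P : Measure (EuclideanSpace ℝ (Fin d)))
    (L : Matrix (Fin d) (Fin d) ℝ) : EReal :=
  ⨆ (Q : Measure (EuclideanSpace ℝ (Fin d)))
    (_ : IsProbabilityMeasure Q ∧ MemLp id 2 Q ∧ (L - covMat Q).PosSemidef),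
    (u : EReal) * diffEntropy ((P.conv (gaussianIso d u)).conv Q) + diffEntropy P
      - ((1 + u : ℝ) : EReal) * diffEntropy (P.conv (gaussianIso d u))

/-- `Θ(P, L) = (u/2) ln((2πe)^d det(cov(P) + uI + L)) + h(P) - (1 + u) h(P * γ_{uI})`. -/
def Theta {d : ℕ} (u : ℝ) (P : Measure (EuclideanSpace ℝ (Fin d)))
    (L : Matrix (Fin d) (Fin d) ℝ) : EReal :=
  ((u / 2 * Real.log ((2 * Real.pi * Real.exp 1) ^ d *
      (covMat P + u • (1 : Matrix (Fin d) (Fin d) ℝ) + L).det) : ℝ) : EReal)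
    + diffEntropy P
    - ((1 + u : ℝ) : EReal) * diffEntropy (P.conv (gaussianIso d u))

/-- `Φ(L)`: the supremum of `Θ(γ_K, L)` over all positive semidefinite `K`. -/
def Phi {d : ℕ} (u : ℝ) (L : Matrix (Fin d) (Fin d) ℝ) : EReal :=
  ⨆ (K : Matrix (Fin d) (Fin d) ℝ) (_ : K.PosSemidef), Theta u (gaussianCov K) L

/-- `‖P - Q‖_{L^∞(Q)}`: the essential supremum, with respect to `Q`, of the absolute value of the
density of `P - Q` with respect to `Q`; it is `∞` if there is no such density. -/
def linftyDist {d : ℕ} (P Q : Measure (EuclideanSpace ℝ (Fin d))) : ℝ≥0∞ :=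
  open Classical in
  if P ≪ Q then eLpNorm (fun x => (P.rnDeriv Q x).toReal - 1) ∞ Q else ∞

end

/-!
Since a Gaussian maximizes the entropy among the laws of given covariance, `Ψ ≤ Θ`, so only `Θ`
matters. Let `G` be the centered Gaussian with the covariance of `P`. Then
`Θ(G, L) - Θ(P, L) = D(P ‖ G) - (1 + u) D(P ∗ γ_{uI} ‖ G ∗ γ_{uI})`, and `Θ(G, L) ≤ Φ(L)`: it
suffices that adding `γ_{uI}` contracts the divergence from `G` by the factor `1 / (1 + u)`.

After whitening, adding `γ_{uI}` loses at least as much as an Ornstein-Uhlenbeck step of some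
correlation `ρ` with `(1 + u) ρ ^ 6 < 1`; the eigenvalue bound on `K` is exactly what allows this.
Near the standard Gaussian the divergence is comparable to half the squared `L²` norm of `f`, the
difference of the densities of `P` and `G` with respect to the standard Gaussian. As `P` and `G`
share their moments up to order two, `f` is orthogonal to the polynomials of degree at most two, and
on such functions the Ornstein-Uhlenbeck operator `T_ρ` contracts the squared norm by `ρ ^ 6`. For
the latter no Hermite expansion is needed:
`⟨f, T_t f⟩ = O(t ^ 3)` by the Taylor expansion of the Mehler kernel, and iterating the
Cauchy-Schwarz inequality `⟨f, T_t f⟩ ^ 2 ≤ ‖f‖ ^ 2 ⟨f, T_{t²} f⟩` turns this into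
`⟨f, T_t f⟩ ≤ ‖f‖ ^ 2 t ^ 3`.

If `K` is singular, then `P ≪ γ_K` has no Lebesgue density and both functionals are `-∞`.
-/

section Bounded

variable {Ω : Type*} [MeasurableSpace Ω] {μ : Measure Ω} [IsFiniteMeasure μ] {f : Ω → ℝ} {C : ℝ}

lemma memLp_of_forall_abs_le {p : ℝ≥0∞} (hf : Measurable f) (hC : ∀ x, |f x| ≤ C) : MemLp f p μ :=
  MemLp.of_bound hf.aestronglyMeasurable C (ae_of_all _ hC)

lemma integrable_of_forall_abs_le (hf : Measurable f) (hC : ∀ x, |f x| ≤ C) : Integrable f μ :=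
  memLp_one_iff_integrable.1 (memLp_of_forall_abs_le hf hC)

end Bounded

section GaussianReflection

variable {E : Type*} [NormedAddCommGroup E] [NormedSpace ℝ E] [SecondCountableTopology E]
  [CompleteSpace E] [MeasurableSpace E] [BorelSpace E]

lemma measurePreserving_reflection_of_isGaussian {μ : Measure E} [IsGaussian μ] (hμ : μ[id] = 0)
    {t σ : ℝ} (h : t ^ 2 + σ ^ 2 = 1) :
    MeasurePreserving (fun p : E × E ↦ (t • p.1 + σ • p.2, σ • p.1 - t • p.2))
      (μ.prod μ) (μ.prod μ) := by
  obtain ⟨θ, hθ⟩ : ∃ θ : ℝ, Complex.exp (θ * Complex.I) = ⟨σ, -t⟩ :=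
    (Complex.norm_eq_one_iff _).1 <| by
      simp [Complex.norm_def, Complex.normSq_apply, ← pow_two, add_comm (σ ^ 2), h]
  have hcos : Real.cos θ = σ := by simpa [Complex.exp_ofReal_mul_I_re] using congrArg Complex.re hθ
  have hsin : Real.sin θ = -t := by simpa [Complex.exp_ofReal_mul_I_im] using congrArg Complex.im hθ
  have hrot : MeasurePreserving (ContinuousLinearMap.rotation θ) (μ.prod μ) (μ.prod μ) :=
    ⟨by fun_prop, IsGaussian.map_rotation_eq_self hμ θ⟩
  convert Measure.measurePreserving_swap.comp hrot using 1
  ext p <;> simp [ContinuousLinearMap.rotation, hcos, hsin, sub_eq_add_neg]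

end GaussianReflection

lemma smul_add_smul_reflection {E : Type*} [AddCommGroup E] [Module ℝ E] {t σ : ℝ}
    (h : t ^ 2 + σ ^ 2 = 1) (x w : E) :
    t • (t • x + σ • w) + σ • (σ • x - t • w) = x :=
  calc t • (t • x + σ • w) + σ • (σ • x - t • w) = (t ^ 2 + σ ^ 2) • x := by module
    _ = x := by rw [h, one_smul]

section OrnsteinUhlenbeck

variable {E : Type*} [NormedAddCommGroup E] [InnerProductSpace ℝ E] [FiniteDimensional ℝ E]
  [MeasurableSpace E] [BorelSpace E]

lemma measurePreserving_reflection_stdGaussian {t σ : ℝ} (h : t ^ 2 + σ ^ 2 = 1) :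
    MeasurePreserving (fun p : E × E ↦ (t • p.1 + σ • p.2, σ • p.1 - t • p.2))
      ((stdGaussian E).prod (stdGaussian E)) ((stdGaussian E).prod (stdGaussian E)) :=
  measurePreserving_reflection_of_isGaussian integral_id_stdGaussian h

lemma lintegral_mul_comp_smul_add_smul_comm {t σ : ℝ} (h : t ^ 2 + σ ^ 2 = 1) {f g : E → ℝ≥0∞}
    (hf : Measurable f) (hg : Measurable g) :
    ∫⁻ x, ∫⁻ w, f x * g (t • x + σ • w) ∂(stdGaussian E) ∂(stdGaussian E) =
      ∫⁻ x, ∫⁻ w, f (t • x + σ • w) * g x ∂(stdGaussian E) ∂(stdGaussian E) := by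
  rw [lintegral_lintegral (by fun_prop), lintegral_lintegral (by fun_prop),
    ← (measurePreserving_reflection_stdGaussian h).lintegral_comp (by fun_prop)]
  simp only [smul_add_smul_reflection h]

lemma integral_mul_comp_smul_add_smul_comm {t σ A B : ℝ} (h : t ^ 2 + σ ^ 2 = 1) {f g : E → ℝ}
    (hf : Measurable f) (hA : ∀ x, |f x| ≤ A) (hg : Measurable g) (hB : ∀ x, |g x| ≤ B) :
    ∫ x, ∫ w, f x * g (t • x + σ • w) ∂(stdGaussian E) ∂(stdGaussian E) =
      ∫ x, ∫ w, f (t • x + σ • w) * g x ∂(stdGaussian E) ∂(stdGaussian E) := by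
  have hbound (x y : E) : |f x * g y| ≤ A * B := by
    rw [abs_mul]
    exact mul_le_mul (hA x) (hB y) (abs_nonneg _) ((abs_nonneg _).trans (hA x))
  rw [integral_integral (integrable_of_forall_abs_le (by fun_prop) fun p ↦ hbound _ _),
    integral_integral (integrable_of_forall_abs_le (by fun_prop) fun p ↦ hbound _ _)]
  conv_lhs => rw [← (measurePreserving_reflection_stdGaussian h).map_eq]
  rw [integral_map (by fun_prop) (Measurable.aestronglyMeasurable (by fun_prop))]
  simp only [smul_add_smul_reflection h]

lemma integral_comp_smul_add_smul_stdGaussian {C : ℝ} (a b : ℝ) {f : E → ℝ} (hf : Measurable f)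
    (hC : ∀ x, |f x| ≤ C) :
    ∫ x, ∫ w, f (a • x + b • w) ∂(stdGaussian E) ∂(stdGaussian E) =
      ∫ x, f (√(a ^ 2 + b ^ 2) • x) ∂(stdGaussian E) := by
  obtain h0 | hpos := (by positivity : 0 ≤ a ^ 2 + b ^ 2).eq_or_lt
  · obtain ⟨rfl, rfl⟩ : a = 0 ∧ b = 0 := ⟨by nlinarith, by nlinarith⟩
    simp
  set r := √(a ^ 2 + b ^ 2) with hr
  have hr0 : r ≠ 0 := (Real.sqrt_pos.2 hpos).ne'
  have hunit : (a / r) ^ 2 + (b / r) ^ 2 = 1 := by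
    rw [div_pow, div_pow, ← add_div, hr, Real.sq_sqrt hpos.le, div_self hpos.ne']
  have hcomm := integral_mul_comp_smul_add_smul_comm (E := E) hunit (f := fun x ↦ f (r • x))
    (g := fun _ ↦ 1) (by fun_prop) (fun x ↦ hC _) measurable_const (fun _ ↦ abs_one.le)
  simpa [smul_smul, mul_div_cancel₀ _ hr0] using hcomm.symm

/-- The Ornstein-Uhlenbeck (noise) operator with correlation `t`, i.e. `e^{-s}` at time `s`. -/
noncomputable def ouOperator (t : ℝ) (f : E → ℝ) (x : E) : ℝ :=
  ∫ w, f (t • x + √(1 - t ^ 2) • w) ∂(stdGaussian E)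

lemma measurable_ouOperator {t : ℝ} {f : E → ℝ} (hf : Measurable f) :
    Measurable (ouOperator t f) := by
  have hm : StronglyMeasurable (fun p : E × E ↦ f (t • p.1 + √(1 - t ^ 2) • p.2)) :=
    Measurable.stronglyMeasurable (by fun_prop)
  exact hm.integral_prod_right'.measurable

lemma abs_ouOperator_le {t C : ℝ} {f : E → ℝ} (hC : ∀ x, |f x| ≤ C) (x : E) :
    |ouOperator t f x| ≤ C := by
  simpa [ouOperator] using norm_integral_le_of_norm_le_const (μ := stdGaussian E)
    (f := fun w ↦ f (t • x + √(1 - t ^ 2) • w)) (ae_of_all _ fun w ↦ hC _)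

lemma one_sub_sq_nonneg {t : ℝ} (h0 : 0 ≤ t) (h1 : t ≤ 1) : 0 ≤ 1 - t ^ 2 :=
  sub_nonneg.2 (pow_le_one₀ h0 h1)

lemma sq_add_sqrt_one_sub_sq {t : ℝ} (h0 : 0 ≤ t) (h1 : t ≤ 1) : t ^ 2 + √(1 - t ^ 2) ^ 2 = 1 := by
  rw [Real.sq_sqrt (one_sub_sq_nonneg h0 h1), add_sub_cancel]

lemma ouOperator_ouOperator {s t C : ℝ} (hs0 : 0 ≤ s) (hs1 : s ≤ 1) (ht0 : 0 ≤ t) (ht1 : t ≤ 1)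
    {f : E → ℝ} (hf : Measurable f) (hC : ∀ x, |f x| ≤ C) :
    ouOperator s (ouOperator t f) = ouOperator (s * t) f := by
  ext x
  have hvar : (t * √(1 - s ^ 2)) ^ 2 + √(1 - t ^ 2) ^ 2 = 1 - (s * t) ^ 2 := by
    rw [mul_pow, Real.sq_sqrt (one_sub_sq_nonneg hs0 hs1), Real.sq_sqrt (one_sub_sq_nonneg ht0 ht1)]
    ring
  have hadd := integral_comp_smul_add_smul_stdGaussian (E := E) (t * √(1 - s ^ 2)) √(1 - t ^ 2)
    (f := fun y ↦ f ((s * t) • x + y)) (by fun_prop) (fun y ↦ hC _)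
  simpa only [ouOperator, hvar, smul_add, smul_smul, add_assoc, mul_comm t s] using hadd

lemma integral_mul_ouOperator_comm {t A B : ℝ} (h0 : 0 ≤ t) (h1 : t ≤ 1) {f g : E → ℝ}
    (hf : Measurable f) (hA : ∀ x, |f x| ≤ A) (hg : Measurable g) (hB : ∀ x, |g x| ≤ B) :
    ∫ x, f x * ouOperator t g x ∂(stdGaussian E) =
      ∫ x, ouOperator t f x * g x ∂(stdGaussian E) := by
  simpa only [ouOperator, integral_const_mul, integral_mul_const] using
    integral_mul_comp_smul_add_smul_comm (sq_add_sqrt_one_sub_sq h0 h1) hf hA hg hB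

lemma integral_ouOperator_sq {t C : ℝ} (h0 : 0 ≤ t) (h1 : t ≤ 1) {f : E → ℝ} (hf : Measurable f)
    (hC : ∀ x, |f x| ≤ C) :
    ∫ x, ouOperator t f x ^ 2 ∂(stdGaussian E) =
      ∫ x, f x * ouOperator (t ^ 2) f x ∂(stdGaussian E) := by
  simp only [pow_two, ← ouOperator_ouOperator h0 h1 h0 h1 hf hC]
  exact (integral_mul_ouOperator_comm h0 h1 hf hC (measurable_ouOperator hf)
    (abs_ouOperator_le hC)).symm

end OrnsteinUhlenbeck

section MehlerTaylor

variable {n t q N : ℝ}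

/-- The logarithm of the Mehler kernel of correlation `t` in dimension `n` at `(x, y)`, where `q`
stands for `⟪x, y⟫` and `N` for `‖x‖² + ‖y‖²`. -/
noncomputable def mehlerExponent (n t q N : ℝ) : ℝ :=
  -(n / 2) * Real.log (1 - t ^ 2) + (t * q - t ^ 2 * N / 2) / (1 - t ^ 2)

/-- The second order Taylor polynomial at `t = 0` of the Mehler kernel
`exp (mehlerExponent n t q N)`. -/
noncomputable def mehlerTaylor (n t q N : ℝ) : ℝ :=
  1 + t * q + t ^ 2 * ((n - N) / 2 + q ^ 2 / 2)

lemma abs_exp_sub_quadratic_le (x : ℝ) :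
    |Real.exp x - (1 + x + x ^ 2 / 2)| ≤ |x| ^ 3 * Real.exp |x| := by
  have hsum : Complex.exp x - ∑ m ∈ Finset.range 3, (x : ℂ) ^ m / (m.factorial : ℂ)
      = ((Real.exp x - (1 + x + x ^ 2 / 2) : ℝ) : ℂ) := by
    simp [Finset.sum_range_succ, Nat.factorial]
  simpa only [hsum, Complex.norm_real, Real.norm_eq_abs] using
    Complex.norm_exp_sub_sum_le_norm_mul_exp x 3

lemma abs_log_one_sub_sq_add_sq_le (h0 : 0 ≤ t) (h1 : t ≤ 1 / 2) :
    |Real.log (1 - t ^ 2) + t ^ 2| ≤ 2 * t ^ 3 := by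
  have ht2 : t ^ 2 ≤ 1 / 4 := by nlinarith
  have hlog := Real.abs_log_sub_add_sum_range_le (x := t ^ 2)
    (by rw [abs_of_nonneg (sq_nonneg t)]; linarith) 1
  simp only [Finset.range_one, Finset.sum_singleton, zero_add, pow_one, Nat.cast_zero, div_one,
    abs_of_nonneg (sq_nonneg t)] at hlog
  rw [add_comm]
  refine hlog.trans ?_
  rw [div_le_iff₀ (by linarith)]
  calc (t ^ 2) ^ (1 + 1) = t ^ 3 * t := by ring
    _ ≤ t ^ 3 * (2 * (1 - t ^ 2)) := by gcongr; linarith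
    _ = 2 * t ^ 3 * (1 - t ^ 2) := by ring

lemma abs_div_one_sub_sq_sub_le (h0 : 0 ≤ t) (h1 : t ≤ 1 / 2) (hq : |q| ≤ N / 2) :
    |(t * q - t ^ 2 * N / 2) / (1 - t ^ 2) - (t * q - t ^ 2 * N / 2)| ≤ t ^ 3 * N := by
  have hN : 0 ≤ N := by linarith [abs_nonneg q]
  have ht2 : t ^ 2 ≤ 1 / 4 := by nlinarith
  have hpos : 0 < 1 - t ^ 2 := by linarith
  have hfactor : (t * q - t ^ 2 * N / 2) / (1 - t ^ 2) - (t * q - t ^ 2 * N / 2)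
      = t ^ 3 * ((q - t * N / 2) / (1 - t ^ 2)) := by
    field_simp
    ring
  have hq' := abs_le.1 hq
  rw [hfactor, abs_mul, abs_of_nonneg (pow_nonneg h0 3)]
  gcongr
  rw [abs_div, abs_of_pos hpos, div_le_iff₀ hpos, abs_le]
  constructor <;> nlinarith [mul_nonneg h0 hN]

lemma abs_mehlerExponent_sub_quadratic_le (hn : 0 ≤ n) (h0 : 0 ≤ t) (h1 : t ≤ 1 / 2)
    (hq : |q| ≤ N / 2) :
    |mehlerExponent n t q N - (t * q + t ^ 2 * ((n - N) / 2))| ≤ t ^ 3 * (1 + n + N) := by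
  have hsplit : mehlerExponent n t q N - (t * q + t ^ 2 * ((n - N) / 2)) =
      -(n / 2) * (Real.log (1 - t ^ 2) + t ^ 2) +
        ((t * q - t ^ 2 * N / 2) / (1 - t ^ 2) - (t * q - t ^ 2 * N / 2)) := by
    rw [mehlerExponent]
    ring
  rw [hsplit]
  calc _ ≤ n / 2 * |Real.log (1 - t ^ 2) + t ^ 2| + t ^ 3 * N := by
        grw [abs_add_le, abs_mul, abs_neg, abs_of_nonneg (by linarith : 0 ≤ n / 2),
          abs_div_one_sub_sq_sub_le h0 h1 hq]
    _ ≤ n / 2 * (2 * t ^ 3) + t ^ 3 * N := by grw [abs_log_one_sub_sq_add_sq_le h0 h1]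
    _ ≤ t ^ 3 * (1 + n + N) := by linarith [pow_nonneg h0 3]

lemma abs_mehlerExponent_sub_linear_le (hn : 0 ≤ n) (h0 : 0 ≤ t) (h1 : t ≤ 1 / 2)
    (hq : |q| ≤ N / 2) : |mehlerExponent n t q N - t * q| ≤ 2 * t ^ 2 * (1 + n + N) := by
  have hN : 0 ≤ N := by linarith [abs_nonneg q]
  have hquad : |t ^ 2 * ((n - N) / 2)| ≤ t ^ 2 * (1 + n + N) := by
    rw [abs_mul, abs_of_nonneg (sq_nonneg t)]
    gcongr
    rw [abs_le]
    constructor <;> linarith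
  calc |mehlerExponent n t q N - t * q|
      = |mehlerExponent n t q N - (t * q + t ^ 2 * ((n - N) / 2)) + t ^ 2 * ((n - N) / 2)| := by
        ring_nf
    _ ≤ t ^ 3 * (1 + n + N) + t ^ 2 * (1 + n + N) := by
        grw [abs_add_le, abs_mehlerExponent_sub_quadratic_le hn h0 h1 hq, hquad]
    _ ≤ 2 * t ^ 2 * (1 + n + N) := by
        have ht3 : t ^ 3 ≤ t ^ 2 := pow_le_pow_of_le_one h0 (by linarith) (by norm_num)
        linarith [mul_le_mul_of_nonneg_right ht3 (by linarith : 0 ≤ 1 + n + N)]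

lemma abs_exp_mehlerExponent_sub_mehlerTaylor_le (hn : 0 ≤ n) (h0 : 0 ≤ t) (h1 : t ≤ 1 / 2)
    (hq : |q| ≤ N / 2) :
    |Real.exp (mehlerExponent n t q N) - mehlerTaylor n t q N| ≤
      12 * t ^ 3 * (1 + n + N) ^ 3 * Real.exp (2 * t * (1 + n + N)) := by
  set θ := mehlerExponent n t q N
  set U := 1 + n + N
  have hU1 : 1 ≤ U := by linarith [abs_nonneg q]
  have htU : 0 ≤ t * U := by positivity
  have hlinear : |θ - t * q| ≤ 2 * t ^ 2 * U := abs_mehlerExponent_sub_linear_le hn h0 h1 hq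
  have htq : |t * q| ≤ t * U / 2 := by
    rw [abs_mul, abs_of_nonneg h0]
    nlinarith
  have ht2U : 2 * t ^ 2 * U ≤ t * U := by nlinarith
  have hθ : |θ| ≤ 2 * t * U := by linarith [abs_sub_abs_le_abs_sub θ (t * q)]
  have hexp : |Real.exp θ - (1 + θ + θ ^ 2 / 2)| ≤ 8 * t ^ 3 * U ^ 3 * Real.exp (2 * t * U) := by
    calc _ ≤ |θ| ^ 3 * Real.exp |θ| := abs_exp_sub_quadratic_le θ
      _ ≤ (2 * t * U) ^ 3 * Real.exp (2 * t * U) := by gcongr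
      _ = 8 * t ^ 3 * U ^ 3 * Real.exp (2 * t * U) := by ring
  have hsq : |θ ^ 2 / 2 - (t * q) ^ 2 / 2| ≤ 3 * t ^ 3 * U ^ 3 := by
    have hfactor : θ ^ 2 / 2 - (t * q) ^ 2 / 2 = (θ - t * q) * (θ + t * q) / 2 := by ring
    have hsum : |θ + t * q| ≤ 3 * t * U := by linarith [abs_add_le θ (t * q)]
    rw [hfactor, abs_div, abs_mul, abs_two]
    calc |θ - t * q| * |θ + t * q| / 2 ≤ 2 * t ^ 2 * U * (3 * t * U) / 2 := by gcongr
      _ = 3 * t ^ 3 * U ^ 2 := by ring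
      _ ≤ 3 * t ^ 3 * U ^ 3 := by gcongr; norm_num
  have hquad : |θ - (t * q + t ^ 2 * ((n - N) / 2))| ≤ t ^ 3 * U ^ 3 := by
    grw [abs_mehlerExponent_sub_quadratic_le hn h0 h1 hq, ← le_self_pow₀ hU1 (by norm_num : 3 ≠ 0)]
  have hsplit : Real.exp θ - mehlerTaylor n t q N = (Real.exp θ - (1 + θ + θ ^ 2 / 2)) +
      (θ ^ 2 / 2 - (t * q) ^ 2 / 2) + (θ - (t * q + t ^ 2 * ((n - N) / 2))) := by
    rw [mehlerTaylor]
    ring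
  have hE : t ^ 3 * U ^ 3 ≤ t ^ 3 * U ^ 3 * Real.exp (2 * t * U) :=
    le_mul_of_one_le_right (by positivity) (Real.one_le_exp (by linarith))
  rw [hsplit]
  linarith [abs_add_three (Real.exp θ - (1 + θ + θ ^ 2 / 2)) (θ ^ 2 / 2 - (t * q) ^ 2 / 2)
    (θ - (t * q + t ^ 2 * ((n - N) / 2)))]

lemma pow_three_le_exp {a : ℝ} (ha : 0 < a) {x : ℝ} (hx : 0 ≤ x) :
    x ^ 3 ≤ 6 / a ^ 3 * Real.exp (a * x) := by
  have h := Real.pow_div_factorial_le_exp (a * x) (by positivity) 3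
  norm_num [Nat.factorial, mul_pow] at h
  rw [div_mul_eq_mul_div, le_div_iff₀ (by positivity)]
  linarith

lemma exists_abs_exp_mehlerExponent_sub_mehlerTaylor_le {b : ℝ} (hn : 0 ≤ n) (hb : 0 < b) :
    ∃ C t₀ : ℝ, 0 < t₀ ∧ t₀ ≤ 1 / 2 ∧ ∀ t q N : ℝ, 0 ≤ t → t ≤ t₀ → |q| ≤ N / 2 →
      |Real.exp (mehlerExponent n t q N) - mehlerTaylor n t q N| ≤
        t ^ 3 * (C * Real.exp (b * N)) := by
  refine ⟨12 * (6 / (b / 2) ^ 3) * Real.exp (b * (1 + n)), min (1 / 2) (b / 4), by positivity,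
    min_le_left _ _, fun t q N h0 h1 hq ↦ ?_⟩
  grw [abs_exp_mehlerExponent_sub_mehlerTaylor_le hn h0 (h1.trans (min_le_left _ _)) hq]
  set U := 1 + n + N with hU
  have hU0 : 0 ≤ U := by linarith [abs_nonneg q]
  have hexp : Real.exp (2 * t * U) ≤ Real.exp (b / 2 * U) := by
    have := h1.trans (min_le_right _ _)
    gcongr
    linarith
  calc 12 * t ^ 3 * U ^ 3 * Real.exp (2 * t * U)
      ≤ 12 * t ^ 3 * (6 / (b / 2) ^ 3 * Real.exp (b / 2 * U)) * Real.exp (b / 2 * U) := by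
        gcongr
        exact pow_three_le_exp (by positivity) hU0
    _ = t ^ 3 * (12 * (6 / (b / 2) ^ 3) * (Real.exp (b / 2 * U) * Real.exp (b / 2 * U))) := by ring
    _ = t ^ 3 * (12 * (6 / (b / 2) ^ 3) * Real.exp (b * (1 + n)) * Real.exp (b * N)) := by
        rw [← Real.exp_add, mul_assoc (12 * (6 / (b / 2) ^ 3)), ← Real.exp_add, hU]
        ring_nf

end MehlerTaylor

section StdGaussianDensity

variable {E : Type*} [NormedAddCommGroup E] [InnerProductSpace ℝ E]

/-- The density of the standard Gaussian measure with respect to the volume. -/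
noncomputable def stdGaussianPDF (E : Type*) [NormedAddCommGroup E] [InnerProductSpace ℝ E]
    (x : E) : ℝ :=
  (2 * Real.pi) ^ (-(Module.finrank ℝ E / 2 : ℝ)) * Real.exp (-‖x‖ ^ 2 / 2)

lemma stdGaussianPDF_pos (x : E) : 0 < stdGaussianPDF E x := by
  unfold stdGaussianPDF
  positivity

lemma exp_mehlerExponent_mul_stdGaussianPDF {t : ℝ} (ht : 0 < 1 - t ^ 2) (x y : E) :
    Real.exp (mehlerExponent (Module.finrank ℝ E) t (inner ℝ x y) (‖x‖ ^ 2 + ‖y‖ ^ 2)) *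
        stdGaussianPDF E y =
      (√(1 - t ^ 2) ^ Module.finrank ℝ E)⁻¹ *
        stdGaussianPDF E ((√(1 - t ^ 2))⁻¹ • (y - t • x)) := by
  set σ := √(1 - t ^ 2)
  have hσ2 : σ ^ 2 = 1 - t ^ 2 := Real.sq_sqrt ht.le
  have hσ0 : 0 < σ := Real.sqrt_pos.2 ht
  have hjac : Real.exp (-(Module.finrank ℝ E / 2 : ℝ) * Real.log (1 - t ^ 2)) =
      (σ ^ Module.finrank ℝ E)⁻¹ := by
    rw [← hσ2, Real.log_pow, ← Real.exp_log (pow_pos hσ0 _), ← Real.exp_neg, Real.log_pow]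
    push_cast
    ring_nf
  have hnorm : ‖σ⁻¹ • (y - t • x)‖ ^ 2
      = (‖y‖ ^ 2 - 2 * t * inner ℝ x y + t ^ 2 * ‖x‖ ^ 2) / (1 - t ^ 2) := by
    rw [norm_smul, mul_pow, norm_sub_sq_real, inner_smul_right, norm_smul, real_inner_comm,
      Real.norm_eq_abs, Real.norm_eq_abs, sq_abs, mul_pow, sq_abs, inv_pow, hσ2]
    ring
  have hexp : Real.exp (-((‖y‖ ^ 2 - 2 * t * inner ℝ x y + t ^ 2 * ‖x‖ ^ 2) / (1 - t ^ 2)) / 2)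
      = Real.exp (-‖y‖ ^ 2 / 2) *
        Real.exp ((t * inner ℝ x y - t ^ 2 * (‖x‖ ^ 2 + ‖y‖ ^ 2) / 2) / (1 - t ^ 2)) := by
    rw [← Real.exp_add]
    congr 1
    field_simp
    ring
  rw [stdGaussianPDF, stdGaussianPDF, hnorm, hexp, mehlerExponent, Real.exp_add, hjac]
  ring

variable [MeasurableSpace E] [BorelSpace E]

lemma measurable_stdGaussianPDF : Measurable (stdGaussianPDF E) := by
  unfold stdGaussianPDF
  fun_prop

variable [FiniteDimensional ℝ E]

lemma integral_stdGaussianPDF : ∫ x, stdGaussianPDF E x = 1 := by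
  have hgauss := GaussianFourier.integral_rexp_neg_mul_sq_norm (V := E) (b := 1 / 2) (by norm_num)
  simp only [stdGaussianPDF, integral_const_mul, neg_div, div_eq_inv_mul (‖_‖ ^ 2)]
  simp only [one_div, neg_mul, div_inv_eq_mul] at hgauss
  rw [hgauss, mul_comm Real.pi, ← Real.rpow_add (by positivity), neg_add_cancel, Real.rpow_zero]

lemma integrable_stdGaussianPDF : Integrable (stdGaussianPDF E) :=
  Integrable.of_integral_ne_zero (by simp [integral_stdGaussianPDF])

lemma isProbabilityMeasure_withDensity_stdGaussianPDF :
    IsProbabilityMeasure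
      ((volume : Measure E).withDensity fun x ↦ ENNReal.ofReal (stdGaussianPDF E x)) where
  measure_univ := by
    rw [withDensity_apply _ MeasurableSet.univ, Measure.restrict_univ,
      ← ofReal_integral_eq_lintegral_ofReal integrable_stdGaussianPDF
        (ae_of_all _ fun x ↦ (stdGaussianPDF_pos x).le), integral_stdGaussianPDF,
      ENNReal.ofReal_one]

lemma charFun_withDensity_stdGaussianPDF (t : E) :
    charFun ((volume : Measure E).withDensity fun x ↦ ENNReal.ofReal (stdGaussianPDF E x)) t =
      Complex.exp (-(‖t‖ ^ 2 / 2)) := by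
  have hintegrand (x : E) : (ENNReal.ofReal (stdGaussianPDF E x)).toReal •
      Complex.exp ((inner ℝ x t : ℝ) * Complex.I)
      = (((2 * Real.pi) ^ (-(Module.finrank ℝ E / 2 : ℝ)) : ℝ) : ℂ) *
        Complex.exp (-(1 / 2) * ‖x‖ ^ 2 + Complex.I * (inner ℝ t x : ℝ)) := by
    rw [ENNReal.toReal_ofReal (stdGaussianPDF_pos x).le, stdGaussianPDF, Complex.real_smul,
      Complex.exp_add, real_inner_comm]
    push_cast
    ring_nf
  have hconst : ((Real.pi : ℂ) / (1 / 2)) ^ ((Module.finrank ℝ E : ℂ) / 2)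
      = (((2 * Real.pi) ^ ((Module.finrank ℝ E / 2 : ℝ)) : ℝ) : ℂ) := by
    rw [Complex.ofReal_cpow (by positivity)]
    push_cast
    ring_nf
  rw [charFun_apply, integral_withDensity_eq_integral_toReal_smul
    measurable_stdGaussianPDF.ennreal_ofReal (by simp)]
  simp only [hintegrand, integral_const_mul]
  rw [GaussianFourier.integral_cexp_neg_mul_sq_norm_add (by norm_num) Complex.I t, hconst,
    ← mul_assoc, ← Complex.ofReal_mul, ← Real.rpow_add (by positivity), neg_add_cancel,
    Real.rpow_zero, Complex.ofReal_one, one_mul, Complex.I_sq]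
  ring_nf

lemma stdGaussian_eq_withDensity :
    stdGaussian E = volume.withDensity fun x ↦ ENNReal.ofReal (stdGaussianPDF E x) := by
  have := isProbabilityMeasure_withDensity_stdGaussianPDF (E := E)
  refine Measure.ext_of_charFun (funext fun t ↦ ?_)
  rw [charFun_stdGaussian, charFun_withDensity_stdGaussianPDF, neg_div]

lemma integral_stdGaussian_eq (f : E → ℝ) :
    ∫ x, f x ∂(stdGaussian E) = ∫ x, stdGaussianPDF E x * f x := by
  rw [stdGaussian_eq_withDensity, integral_withDensity_eq_integral_toReal_smul
    measurable_stdGaussianPDF.ennreal_ofReal (by simp)]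
  simp only [ENNReal.toReal_ofReal (stdGaussianPDF_pos _).le, smul_eq_mul]

lemma ouOperator_eq_integral_mehler {t : ℝ} (h0 : 0 ≤ t) (h1 : t < 1) (f : E → ℝ) (x : E) :
    ouOperator t f x = ∫ y, f y * Real.exp (mehlerExponent (Module.finrank ℝ E) t (inner ℝ x y)
      (‖x‖ ^ 2 + ‖y‖ ^ 2)) ∂(stdGaussian E) := by
  have ht : 0 < 1 - t ^ 2 := by nlinarith
  have hσ0 : 0 < √(1 - t ^ 2) := Real.sqrt_pos.2 ht
  set k : E → ℝ := fun y ↦ stdGaussianPDF E ((√(1 - t ^ 2))⁻¹ • (y - t • x)) * f y with hk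
  have hsubst (w : E) : stdGaussianPDF E w * f (t • x + √(1 - t ^ 2) • w) =
      k (t • x + √(1 - t ^ 2) • w) := by
    simp [hk, smul_smul, inv_mul_cancel₀ hσ0.ne']
  simp only [ouOperator, integral_stdGaussian_eq, hsubst]
  rw [Measure.integral_comp_smul volume (fun y ↦ k (t • x + y)), integral_add_left_eq_self,
    smul_eq_mul, ← integral_const_mul, abs_of_pos (by positivity)]
  congr 1 with y
  linear_combination (-f y) * exp_mehlerExponent_mul_stdGaussianPDF ht x y

end StdGaussianDensity

section CauchySchwarz

variable {Ω : Type*} [MeasurableSpace Ω] {μ : Measure Ω} {f g : Ω → ℝ}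

lemma sq_integral_mul_le (hf : MemLp f 2 μ) (hg : MemLp g 2 μ) :
    (∫ x, f x * g x ∂μ) ^ 2 ≤ (∫ x, f x ^ 2 ∂μ) * ∫ x, g x ^ 2 ∂μ := by
  have hinner {u v : Ω → ℝ} (hu : MemLp u 2 μ) (hv : MemLp v 2 μ) :
      inner ℝ hu.toLp hv.toLp = ∫ x, u x * v x ∂μ := by
    rw [L2.inner_def]
    refine integral_congr_ae ?_
    filter_upwards [hu.coeFn_toLp, hv.coeFn_toLp] with x hux hvx
    simp [hux, hvx, mul_comm]
  simpa only [hinner, pow_two] using real_inner_mul_inner_self_le hf.toLp hg.toLp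

end CauchySchwarz

section SquareIteration

lemma le_mul_pow_of_sq_le_mul_comp_sq {a : ℝ → ℝ} {A B t₀ x : ℝ} {k : ℕ} (hA : 0 ≤ A)
    (hsq : ∀ t, 0 < t → t < 1 → a t ^ 2 ≤ A * a (t ^ 2)) (ht₀ : 0 < t₀)
    (hB : ∀ t, 0 < t → t < t₀ → a t ≤ B * t ^ k) (hx0 : 0 < x) (hx1 : x < 1) :
    a x ≤ A * x ^ k := by
  by_contra! hlt
  obtain rfl | hA := hA.eq_or_lt
  · nlinarith [hsq x hx0 hx1]
  set R := a x / (A * x ^ k) with hR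
  have hR1 : 1 < R := (one_lt_div (by positivity)).2 hlt
  -- squaring the argument squares the ratio of `a t` and `A * t ^ k`
  have hiter (m : ℕ) : R ^ 2 ^ m * (A * (x ^ 2 ^ m) ^ k) ≤ a (x ^ 2 ^ m) := by
    induction m with
    | zero => rw [pow_zero, pow_one, pow_one, hR, div_mul_cancel₀ _ (by positivity)]
    | succ m ih =>
      refine le_of_mul_le_mul_left ?_ hA
      calc A * (R ^ 2 ^ (m + 1) * (A * (x ^ 2 ^ (m + 1)) ^ k))
          = (R ^ 2 ^ m * (A * (x ^ 2 ^ m) ^ k)) ^ 2 := by rw [pow_succ 2 m, pow_mul, pow_mul]; ring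
        _ ≤ a (x ^ 2 ^ m) ^ 2 := by gcongr
        _ ≤ A * a ((x ^ 2 ^ m) ^ 2) :=
            hsq _ (by positivity) (pow_lt_one₀ hx0.le hx1 (by positivity))
        _ = A * a (x ^ 2 ^ (m + 1)) := by rw [← pow_mul, ← pow_succ]
  have htwo : Filter.Tendsto (fun m : ℕ ↦ 2 ^ m) Filter.atTop Filter.atTop :=
    tendsto_pow_atTop_atTop_of_one_lt (by norm_num)
  have hRtop : Filter.Tendsto (fun m : ℕ ↦ R ^ 2 ^ m) Filter.atTop Filter.atTop :=
    (tendsto_pow_atTop_atTop_of_one_lt hR1).comp htwo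
  have hxzero : Filter.Tendsto (fun m : ℕ ↦ x ^ 2 ^ m) Filter.atTop (nhds 0) :=
    (tendsto_pow_atTop_nhds_zero_of_lt_one hx0.le hx1).comp htwo
  obtain ⟨m, hRm, hxm⟩ := ((hRtop.eventually_gt_atTop (B / A)).and
    (hxzero.eventually (Iio_mem_nhds ht₀))).exists
  have hle : R ^ 2 ^ m * A ≤ B := by
    refine le_of_mul_le_mul_right ?_ (by positivity : 0 < (x ^ 2 ^ m) ^ k)
    linarith [(hiter m).trans (hB _ (by positivity) hxm)]
  rw [div_lt_iff₀ hA] at hRm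
  linarith

end SquareIteration

section OrthQuadratic

lemma abs_real_inner_le_norm_sq_add_norm_sq {E : Type*} [SeminormedAddCommGroup E]
    [InnerProductSpace ℝ E] (x y : E) : |inner ℝ x y| ≤ (‖x‖ ^ 2 + ‖y‖ ^ 2) / 2 := by
  linarith [abs_real_inner_le_norm x y, two_mul_le_add_sq ‖x‖ ‖y‖]

variable {E : Type*} [NormedAddCommGroup E] [InnerProductSpace ℝ E] [FiniteDimensional ℝ E]
  [MeasurableSpace E] [BorelSpace E]

/-- Orthogonality of `f` to the polynomials of degree at most two in `L²` of the standard Gaussian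
measure. By polarisation it is enough to test against squares of linear forms in degree two. -/
structure OrthQuadratic (f : E → ℝ) : Prop where
  zero : ∫ x, f x ∂(stdGaussian E) = 0
  one : ∀ v : E, ∫ x, f x * inner ℝ v x ∂(stdGaussian E) = 0
  two : ∀ v : E, ∫ x, f x * inner ℝ v x ^ 2 ∂(stdGaussian E) = 0

lemma integrable_inner_stdGaussian (v : E) : Integrable (fun x ↦ inner ℝ v x) (stdGaussian E) :=
  (IsGaussian.integrable_id (μ := stdGaussian E)).const_inner v

lemma integrable_inner_sq_stdGaussian (v : E) :
    Integrable (fun x ↦ inner ℝ v x ^ 2) (stdGaussian E) :=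
  ((IsGaussian.memLp_two_id (μ := stdGaussian E)).const_inner (𝕜 := ℝ) v).integrable_sq

lemma integrable_norm_sq_stdGaussian : Integrable (fun x : E ↦ ‖x‖ ^ 2) (stdGaussian E) :=
  (IsGaussian.memLp_two_id (μ := stdGaussian E)).integrable_norm_pow (by norm_num)

namespace OrthQuadratic

variable {f : E → ℝ} {C : ℝ}

lemma integral_mul_norm_sq (h : OrthQuadratic f) (hf : Measurable f) (hC : ∀ x, |f x| ≤ C) :
    ∫ x, f x * ‖x‖ ^ 2 ∂(stdGaussian E) = 0 := by
  simp only [← (stdOrthonormalBasis ℝ E).sum_sq_inner_right, Finset.mul_sum]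
  rw [integral_finsetSum _ fun i _ ↦
    (integrable_inner_sq_stdGaussian _).bdd_mul hf.aestronglyMeasurable (ae_of_all _ hC)]
  exact Finset.sum_eq_zero fun i _ ↦ h.two _

lemma integrable_and_integral_mul_mehlerTaylor_eq_zero (h : OrthQuadratic f) (hf : Measurable f)
    (hC : ∀ x, |f x| ≤ C) (n t : ℝ) (x : E) :
    Integrable (fun y ↦ f y * mehlerTaylor n t (inner ℝ x y) (‖x‖ ^ 2 + ‖y‖ ^ 2)) (stdGaussian E) ∧
      ∫ y, f y * mehlerTaylor n t (inner ℝ x y) (‖x‖ ^ 2 + ‖y‖ ^ 2) ∂(stdGaussian E) = 0 := by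
  have hfmul {g : E → ℝ} (hg : Integrable g (stdGaussian E)) :
      Integrable (fun y ↦ f y * g y) (stdGaussian E) :=
    hg.bdd_mul hf.aestronglyMeasurable (ae_of_all _ hC)
  have i0 : Integrable (fun y ↦ (1 + t ^ 2 * (n - ‖x‖ ^ 2) / 2) * f y) (stdGaussian E) :=
    (integrable_of_forall_abs_le hf hC).const_mul _
  have i1 : Integrable (fun y ↦ t * (f y * inner ℝ x y)) (stdGaussian E) :=
    (hfmul (integrable_inner_stdGaussian x)).const_mul _
  have i2 : Integrable (fun y ↦ (-t ^ 2 / 2) * (f y * ‖y‖ ^ 2)) (stdGaussian E) :=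
    (hfmul integrable_norm_sq_stdGaussian).const_mul _
  have i3 : Integrable (fun y ↦ (t ^ 2 / 2) * (f y * inner ℝ x y ^ 2)) (stdGaussian E) :=
    (hfmul (integrable_inner_sq_stdGaussian x)).const_mul _
  have hexpand : (fun y ↦ f y * mehlerTaylor n t (inner ℝ x y) (‖x‖ ^ 2 + ‖y‖ ^ 2)) =
      fun y ↦ (1 + t ^ 2 * (n - ‖x‖ ^ 2) / 2) * f y + t * (f y * inner ℝ x y)
        + (-t ^ 2 / 2) * (f y * ‖y‖ ^ 2) + (t ^ 2 / 2) * (f y * inner ℝ x y ^ 2) := by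
    ext y
    rw [mehlerTaylor]
    ring
  rw [hexpand]
  refine ⟨((i0.add i1).add i2).add i3, ?_⟩
  rw [integral_add ((i0.fun_add i1).fun_add i2) i3, integral_add (i0.fun_add i1) i2,
    integral_add i0 i1]
  simp only [integral_const_mul, h.zero, h.one, h.two, h.integral_mul_norm_sq hf hC, mul_zero,
    add_zero]

lemma exists_abs_ouOperator_le (h : OrthQuadratic f) (hf : Measurable f) (hC : ∀ x, |f x| ≤ C) :
    ∃ b B t₀ : ℝ, 0 < t₀ ∧ Integrable (fun x ↦ Real.exp (b * ‖x‖ ^ 2)) (stdGaussian E) ∧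
      ∀ t, 0 ≤ t → t ≤ t₀ → ∀ x, |ouOperator t f x| ≤ B * t ^ 3 * Real.exp (b * ‖x‖ ^ 2) := by
  obtain ⟨b, hb, hint⟩ := IsGaussian.exists_integrable_exp_sq (stdGaussian E)
  set n : ℝ := (Module.finrank ℝ E : ℝ)
  obtain ⟨A, t₀, ht₀, ht₀', hA⟩ :=
    exists_abs_exp_mehlerExponent_sub_mehlerTaylor_le (n := n) (by positivity) hb
  refine ⟨b, C * (A * ∫ x, Real.exp (b * ‖x‖ ^ 2) ∂(stdGaussian E)), t₀, ht₀, hint,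
    fun t h0 h1 x ↦ ?_⟩
  set p : E → ℝ := fun y ↦ mehlerTaylor n t (inner ℝ x y) (‖x‖ ^ 2 + ‖y‖ ^ 2) with hp
  set M : E → ℝ := fun y ↦ Real.exp (mehlerExponent n t (inner ℝ x y) (‖x‖ ^ 2 + ‖y‖ ^ 2)) with hM
  obtain ⟨hfp, hfp0⟩ := h.integrable_and_integral_mul_mehlerTaylor_eq_zero hf hC n t x
  have hbound (y : E) : ‖f y * (M y - p y)‖
      ≤ C * (t ^ 3 * (A * Real.exp (b * ‖x‖ ^ 2))) * Real.exp (b * ‖y‖ ^ 2) := by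
    rw [norm_mul]
    calc ‖f y‖ * ‖M y - p y‖ ≤ C * (t ^ 3 * (A * Real.exp (b * (‖x‖ ^ 2 + ‖y‖ ^ 2)))) :=
          mul_le_mul (hC y) (hA t _ _ h0 h1 (abs_real_inner_le_norm_sq_add_norm_sq x y))
            (norm_nonneg _) ((abs_nonneg _).trans (hC y))
      _ = _ := by rw [mul_add, Real.exp_add]; ring
  have hdiff : Integrable (fun y ↦ f y * (M y - p y)) (stdGaussian E) := by
    refine (hint.const_mul _).mono' (Measurable.aestronglyMeasurable ?_) (ae_of_all _ hbound)
    simp only [hM, hp, mehlerExponent, mehlerTaylor]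
    fun_prop
  have hremainder : ouOperator t f x = ∫ y, f y * (M y - p y) ∂(stdGaussian E) := by
    rw [ouOperator_eq_integral_mehler h0 (by linarith), ← add_zero (∫ y, f y * (M y - p y) ∂_),
      ← hfp0, ← integral_add hdiff hfp]
    congr 1 with y
    ring
  rw [hremainder, ← Real.norm_eq_abs]
  refine (norm_integral_le_of_norm_le (hint.const_mul _) (ae_of_all _ hbound)).trans_eq ?_
  rw [integral_const_mul]
  ring

lemma exists_integral_mul_ouOperator_le (h : OrthQuadratic f) (hf : Measurable f)
    (hC : ∀ x, |f x| ≤ C) :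
    ∃ B t₀ : ℝ, 0 < t₀ ∧ ∀ t, 0 ≤ t → t ≤ t₀ →
      ∫ x, f x * ouOperator t f x ∂(stdGaussian E) ≤ B * t ^ 3 := by
  obtain ⟨b, B, t₀, ht₀, hint, hB⟩ := h.exists_abs_ouOperator_le hf hC
  refine ⟨C * B * ∫ x, Real.exp (b * ‖x‖ ^ 2) ∂(stdGaussian E), t₀, ht₀, fun t h0 h1 ↦ ?_⟩
  have hbound (x : E) : ‖f x * ouOperator t f x‖ ≤ C * B * t ^ 3 * Real.exp (b * ‖x‖ ^ 2) := by
    rw [norm_mul]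
    calc ‖f x‖ * ‖ouOperator t f x‖ ≤ C * (B * t ^ 3 * Real.exp (b * ‖x‖ ^ 2)) :=
          mul_le_mul (hC x) (hB t h0 h1 x) (norm_nonneg _) ((abs_nonneg _).trans (hC x))
      _ = _ := by ring
  calc ∫ x, f x * ouOperator t f x ∂(stdGaussian E)
      ≤ ∫ x, C * B * t ^ 3 * Real.exp (b * ‖x‖ ^ 2) ∂(stdGaussian E) :=
        (le_abs_self _).trans
          (norm_integral_le_of_norm_le (hint.const_mul _) (ae_of_all _ hbound))
    _ = _ := by rw [integral_const_mul]; ring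

lemma integral_ouOperator_sq_le {ρ : ℝ} (h : OrthQuadratic f) (hf : Measurable f)
    (hC : ∀ x, |f x| ≤ C) (h0 : 0 < ρ) (h1 : ρ < 1) :
    ∫ x, ouOperator ρ f x ^ 2 ∂(stdGaussian E) ≤ ρ ^ 6 * ∫ x, f x ^ 2 ∂(stdGaussian E) := by
  obtain ⟨B, t₀, ht₀, hB⟩ := h.exists_integral_mul_ouOperator_le hf hC
  have hsq (t : ℝ) (h0 : 0 < t) (h1 : t < 1) : (∫ x, f x * ouOperator t f x ∂(stdGaussian E)) ^ 2 ≤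
      (∫ x, f x ^ 2 ∂(stdGaussian E)) * ∫ x, f x * ouOperator (t ^ 2) f x ∂(stdGaussian E) := by
    rw [← integral_ouOperator_sq h0.le h1.le hf hC]
    exact sq_integral_mul_le (memLp_of_forall_abs_le hf hC)
      (memLp_of_forall_abs_le (measurable_ouOperator hf) (abs_ouOperator_le hC))
  rw [integral_ouOperator_sq h0.le h1.le hf hC]
  calc _ ≤ (∫ x, f x ^ 2 ∂(stdGaussian E)) * (ρ ^ 2) ^ 3 :=
        le_mul_pow_of_sq_le_mul_comp_sq (a := fun t ↦ ∫ x, f x * ouOperator t f x ∂(stdGaussian E))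
          (integral_nonneg fun x ↦ sq_nonneg _) hsq ht₀ (fun t ht ht' ↦ hB t ht.le ht'.le)
          (by positivity) (pow_lt_one₀ h0.le h1 two_ne_zero)
    _ = _ := by ring

end OrthQuadratic

end OrthQuadratic

section MehlerKernelSquare

lemma exp_mehlerExponent_sq_le {n t q N : ℝ} (h0 : 0 ≤ t) (h1 : t < 1) (hq : |q| ≤ N / 2) :
    Real.exp (mehlerExponent n t q N) ^ 2 ≤
      Real.exp (-n * Real.log (1 - t ^ 2)) * Real.exp (t / (1 + t) * N) := by
  have ht : 0 < 1 - t ^ 2 := by nlinarith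
  rw [← Real.exp_nat_mul, ← Real.exp_add]
  gcongr
  calc ((2 : ℕ) : ℝ) * mehlerExponent n t q N
      = -n * Real.log (1 - t ^ 2) + (t * (2 * q) - t ^ 2 * N) / (1 - t ^ 2) := by
        rw [mehlerExponent]
        push_cast
        ring
    _ ≤ -n * Real.log (1 - t ^ 2) + (t * N - t ^ 2 * N) / (1 - t ^ 2) := by
        gcongr
        linarith [le_abs_self q]
    _ = -n * Real.log (1 - t ^ 2) + t / (1 + t) * N := by
        congr 1
        rw [div_eq_iff ht.ne']
        field_simp
        ring

variable {E : Type*} [NormedAddCommGroup E] [InnerProductSpace ℝ E] [FiniteDimensional ℝ E]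
  [MeasurableSpace E] [BorelSpace E]

lemma integrable_exp_mul_norm_sq_stdGaussian {c : ℝ} (hc : c < 1 / 2) :
    Integrable (fun x ↦ Real.exp (c * ‖x‖ ^ 2)) (stdGaussian E) := by
  refine Integrable.of_integral_ne_zero ?_
  have hexp (x : E) : stdGaussianPDF E x * Real.exp (c * ‖x‖ ^ 2) =
      (2 * Real.pi) ^ (-(Module.finrank ℝ E / 2 : ℝ)) * Real.exp (-(1 / 2 - c) * ‖x‖ ^ 2) := by
    rw [stdGaussianPDF, mul_assoc, ← Real.exp_add]
    ring_nf
  have hpos : 0 < 1 / 2 - c := sub_pos.2 hc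
  simp only [integral_stdGaussian_eq, hexp]
  rw [integral_const_mul, GaussianFourier.integral_rexp_neg_mul_sq_norm hpos]
  positivity

lemma ouOperator_sq_le {t : ℝ} (h0 : 0 ≤ t) (h1 : t < 1) {f : E → ℝ}
    (hf : MemLp f 2 (stdGaussian E)) (x : E) :
    ouOperator t f x ^ 2 ≤ Real.exp (-Module.finrank ℝ E * Real.log (1 - t ^ 2)) *
      (∫ y, Real.exp (t / (1 + t) * ‖y‖ ^ 2) ∂(stdGaussian E)) *
      (∫ y, f y ^ 2 ∂(stdGaussian E)) * Real.exp (t / (1 + t) * ‖x‖ ^ 2) := by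
  set M : E → ℝ := fun y ↦ Real.exp (mehlerExponent (Module.finrank ℝ E) t (inner ℝ x y)
    (‖x‖ ^ 2 + ‖y‖ ^ 2)) with hM
  set κ := t / (1 + t)
  have hκ : κ < 1 / 2 := by rw [div_lt_iff₀ (by linarith)]; linarith
  set c := Real.exp (-Module.finrank ℝ E * Real.log (1 - t ^ 2)) * Real.exp (κ * ‖x‖ ^ 2) with hc
  have hbound (y : E) : M y ^ 2 ≤ c * Real.exp (κ * ‖y‖ ^ 2) := by
    grw [hM, exp_mehlerExponent_sq_le h0 h1 (abs_real_inner_le_norm_sq_add_norm_sq x y), mul_add,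
      Real.exp_add, hc, mul_assoc]
  have hint : Integrable (fun y ↦ c * Real.exp (κ * ‖y‖ ^ 2)) (stdGaussian E) :=
    (integrable_exp_mul_norm_sq_stdGaussian hκ).const_mul c
  have hMmeas : AEStronglyMeasurable M (stdGaussian E) :=
    Measurable.aestronglyMeasurable (by unfold M mehlerExponent; fun_prop)
  have hM2 : Integrable (fun y ↦ M y ^ 2) (stdGaussian E) :=
    hint.mono' (hMmeas.pow 2) (ae_of_all _ fun y ↦ by simpa using hbound y)
  calc ouOperator t f x ^ 2 = (∫ y, f y * M y ∂(stdGaussian E)) ^ 2 := by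
        rw [ouOperator_eq_integral_mehler h0 h1]
    _ ≤ (∫ y, f y ^ 2 ∂(stdGaussian E)) * ∫ y, M y ^ 2 ∂(stdGaussian E) :=
        sq_integral_mul_le hf ((memLp_two_iff_integrable_sq hMmeas).2 hM2)
    _ ≤ (∫ y, f y ^ 2 ∂(stdGaussian E)) * ∫ y, c * Real.exp (κ * ‖y‖ ^ 2) ∂(stdGaussian E) :=
        mul_le_mul_of_nonneg_left (integral_mono hM2 hint hbound)
          (integral_nonneg fun y ↦ sq_nonneg _)
    _ = _ := by rw [integral_const_mul]; ring

lemma exists_integral_ouOperator_sq_mul_exp_le (E : Type*) [NormedAddCommGroup E]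
    [InnerProductSpace ℝ E] [FiniteDimensional ℝ E] [MeasurableSpace E] [BorelSpace E]
    {t : ℝ} (h0 : 0 ≤ t) (h1 : t < 1) :
    ∃ δ B : ℝ, 0 < δ ∧ ∀ f : E → ℝ, Measurable f → MemLp f 2 (stdGaussian E) →
      Integrable (fun x ↦ ouOperator t f x ^ 2 * Real.exp (δ * ‖x‖ ^ 2)) (stdGaussian E) ∧
      ∫ x, ouOperator t f x ^ 2 * Real.exp (δ * ‖x‖ ^ 2) ∂(stdGaussian E) ≤
        B * ∫ x, f x ^ 2 ∂(stdGaussian E) := by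
  set κ := t / (1 + t)
  have hκ : κ < 1 / 2 := by rw [div_lt_iff₀ (by linarith)]; linarith
  obtain ⟨δ, hδ, hδκ⟩ : ∃ δ, 0 < δ ∧ κ + δ < 1 / 2 :=
    ⟨(1 / 2 - κ) / 2, by linarith, by linarith⟩
  set A := Real.exp (-Module.finrank ℝ E * Real.log (1 - t ^ 2)) *
    ∫ y : E, Real.exp (κ * ‖y‖ ^ 2) ∂(stdGaussian E)
  refine ⟨δ, A * ∫ x : E, Real.exp ((κ + δ) * ‖x‖ ^ 2) ∂(stdGaussian E), hδ,
    fun f hf hf2 ↦ ?_⟩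
  set S := ∫ x, f x ^ 2 ∂(stdGaussian E)
  have hbound (x : E) : ouOperator t f x ^ 2 * Real.exp (δ * ‖x‖ ^ 2) ≤
      A * S * Real.exp ((κ + δ) * ‖x‖ ^ 2) := by
    grw [ouOperator_sq_le h0 h1 hf2 x, mul_assoc, ← Real.exp_add, ← add_mul]
  have hint : Integrable (fun x : E ↦ A * S * Real.exp ((κ + δ) * ‖x‖ ^ 2)) (stdGaussian E) :=
    (integrable_exp_mul_norm_sq_stdGaussian hδκ).const_mul _
  have hout : Integrable (fun x ↦ ouOperator t f x ^ 2 * Real.exp (δ * ‖x‖ ^ 2))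
      (stdGaussian E) := by
    have := measurable_ouOperator (t := t) hf
    refine hint.mono' (Measurable.aestronglyMeasurable (by fun_prop)) (ae_of_all _ fun x ↦ ?_)
    rw [Real.norm_of_nonneg (by positivity)]
    exact hbound x
  refine ⟨hout, (integral_mono hout hint hbound).trans_eq ?_⟩
  rw [integral_const_mul]
  ring

end MehlerKernelSquare

section KLBounds

open InformationTheory

lemma monotoneOn_Ioi_of_hasDerivAt_nonneg {f f' : ℝ → ℝ} {a : ℝ}
    (hf : ∀ y ∈ Set.Ioi a, HasDerivAt f (f' y) y) (hf' : ∀ y ∈ Set.Ioi a, 0 ≤ f' y) :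
    MonotoneOn f (Set.Ioi a) :=
  monotoneOn_of_hasDerivWithinAt_nonneg (convex_Ioi a)
    (fun y hy ↦ (hf y hy).continuousAt.continuousWithinAt)
    (fun y hy ↦ (hf y (interior_subset hy)).hasDerivWithinAt)
    (fun y hy ↦ hf' y (interior_subset hy))

lemma monotoneOn_log_sub_quadratic :
    MonotoneOn (fun y : ℝ ↦ Real.log y - (y - 1) + (y - 1) ^ 2 / 2) (Set.Ioi 0) := by
  refine monotoneOn_Ioi_of_hasDerivAt_nonneg (f' := fun y ↦ (y - 1) ^ 2 / y)
    (fun y hy ↦ ?_) (fun y hy ↦ div_nonneg (sq_nonneg _) (Set.mem_Ioi.1 hy).le)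
  have hy0 : y ≠ 0 := (Set.mem_Ioi.1 hy).ne'
  have hsub : HasDerivAt (fun y : ℝ ↦ y - 1) 1 y := (hasDerivAt_id y).sub_const 1
  refine (((Real.hasDerivAt_log hy0).sub hsub).add ((hsub.pow 2).div_const 2)).congr_deriv ?_
  push_cast
  field_simp
  ring

lemma monotoneOn_half_sub_inv_sub_log :
    MonotoneOn (fun y : ℝ ↦ (y - y⁻¹) / 2 - Real.log y) (Set.Ioi 0) := by
  refine monotoneOn_Ioi_of_hasDerivAt_nonneg (f' := fun y ↦ (y - 1) ^ 2 / (2 * y ^ 2))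
    (fun y hy ↦ ?_) (fun y _ ↦ by positivity)
  have hy0 : y ≠ 0 := (Set.mem_Ioi.1 hy).ne'
  refine ((((hasDerivAt_id y).sub (hasDerivAt_inv hy0)).div_const 2).sub
    (Real.hasDerivAt_log hy0)).congr_deriv ?_
  field_simp
  ring

lemma klFun_eq_sub_half_sub_inv {x : ℝ} (hx : 0 < x) :
    klFun x = (x - 1) ^ 2 / 2 - x * ((x - x⁻¹) / 2 - Real.log x) := by
  rw [klFun_apply]
  field_simp
  ring

lemma klFun_eq_sub_log_inv {x : ℝ} (hx : 0 < x) :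
    klFun x = (x - 1) ^ 2 / (2 * x) -
      x * (Real.log x⁻¹ - (x⁻¹ - 1) + (x⁻¹ - 1) ^ 2 / 2) := by
  rw [klFun_apply, Real.log_inv]
  field_simp
  ring

lemma sq_div_two_mul_max_le_klFun {x : ℝ} (hx : 0 < x) :
    (x - 1) ^ 2 / (2 * max x 1) ≤ klFun x := by
  rcases le_total 1 x with h | h
  · have hmono := monotoneOn_log_sub_quadratic (Set.mem_Ioi.2 (inv_pos.2 hx))
      (Set.mem_Ioi.2 one_pos) (inv_le_one_of_one_le₀ h)
    norm_num only [Real.log_one] at hmono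
    rw [max_eq_left h, klFun_eq_sub_log_inv hx]
    linarith [mul_nonpos_of_nonneg_of_nonpos hx.le hmono]
  · have hmono := monotoneOn_half_sub_inv_sub_log (Set.mem_Ioi.2 hx) (Set.mem_Ioi.2 one_pos) h
    norm_num only [Real.log_one] at hmono
    rw [max_eq_right h, klFun_eq_sub_half_sub_inv hx]
    linarith [mul_nonpos_of_nonneg_of_nonpos hx.le hmono]

lemma klFun_le_sq_div_two_mul_min {x : ℝ} (hx : 0 < x) :
    klFun x ≤ (x - 1) ^ 2 / (2 * min x 1) := by
  rcases le_total 1 x with h | h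
  · have hmono := monotoneOn_half_sub_inv_sub_log (Set.mem_Ioi.2 one_pos) (Set.mem_Ioi.2 hx) h
    norm_num only [Real.log_one] at hmono
    rw [min_eq_right h, klFun_eq_sub_half_sub_inv hx]
    linarith [mul_nonneg hx.le hmono]
  · have hmono := monotoneOn_log_sub_quadratic (Set.mem_Ioi.2 one_pos)
      (Set.mem_Ioi.2 (inv_pos.2 hx)) ((one_le_inv₀ hx).2 h)
    norm_num only [Real.log_one] at hmono
    rw [min_eq_left h, klFun_eq_sub_log_inv hx]
    linarith [mul_nonneg hx.le hmono]

lemma sq_sub_div_le_mul_klFun_div {p q M : ℝ} (hp : 0 < p) (hq : 0 < q) (hpM : p ≤ M)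
    (hqM : q ≤ M) : (p - q) ^ 2 / (2 * M) ≤ q * klFun (p / q) := by
  have : 0 < max p q := lt_max_of_lt_left hp
  calc (p - q) ^ 2 / (2 * M) ≤ (p - q) ^ 2 / (2 * max p q) := by
        gcongr
        exact max_le hpM hqM
    _ = q * ((p / q - 1) ^ 2 / (2 * max (p / q) 1)) := by
        have hscale : max (p / q) 1 = max p q / q := by
          rw [← max_div_div_right hq.le, div_self hq.ne']
        rw [hscale]
        field_simp
    _ ≤ q * klFun (p / q) := by
        grw [sq_div_two_mul_max_le_klFun (div_pos hp hq)]

lemma mul_klFun_div_le_sq_sub_div {p q m : ℝ} (hm : 0 < m) (hpm : m ≤ p) (hqm : m ≤ q) :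
    q * klFun (p / q) ≤ (p - q) ^ 2 / (2 * m) := by
  have hp : 0 < p := hm.trans_le hpm
  have hq : 0 < q := hm.trans_le hqm
  have : 0 < min p q := lt_min hp hq
  calc q * klFun (p / q) ≤ q * ((p / q - 1) ^ 2 / (2 * min (p / q) 1)) := by
        grw [klFun_le_sq_div_two_mul_min (div_pos hp hq)]
    _ = (p - q) ^ 2 / (2 * min p q) := by
        have hscale : min (p / q) 1 = min p q / q := by
          rw [← min_div_div_right hq.le, div_self hq.ne']
        rw [hscale]
        field_simp
    _ ≤ (p - q) ^ 2 / (2 * m) := by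
        gcongr
        exact le_min hpm hqm

lemma klDiv_withDensity_withDensity {Ω : Type*} [MeasurableSpace Ω] {μ : Measure Ω} [SigmaFinite μ]
    {F G : Ω → ℝ} (hF : Measurable F) (hG : Measurable G) (hF0 : ∀ x, 0 ≤ F x) (hG0 : ∀ x, 0 < G x)
    [IsFiniteMeasure (μ.withDensity fun x ↦ ENNReal.ofReal (F x))]
    [IsFiniteMeasure (μ.withDensity fun x ↦ ENNReal.ofReal (G x))] :
    klDiv (μ.withDensity fun x ↦ ENNReal.ofReal (F x))
      (μ.withDensity fun x ↦ ENNReal.ofReal (G x)) =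
      ∫⁻ x, ENNReal.ofReal (G x * klFun (F x / G x)) ∂μ := by
  set ν := μ.withDensity fun x ↦ ENNReal.ofReal (G x) with hν
  have hratio : (μ.withDensity fun x ↦ ENNReal.ofReal (F x)) =
      ν.withDensity (fun x ↦ ENNReal.ofReal (F x / G x)) := by
    rw [hν, ← withDensity_mul _ (by fun_prop) (by fun_prop)]
    congr 1
    ext x
    rw [Pi.mul_apply, ← ENNReal.ofReal_mul (hG0 x).le, mul_div_cancel₀ _ (hG0 x).ne']
  have : IsFiniteMeasure (ν.withDensity (fun x ↦ ENNReal.ofReal (F x / G x))) := by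
    rwa [← hratio]
  have := measurable_klFun
  calc klDiv (μ.withDensity fun x ↦ ENNReal.ofReal (F x)) ν =
      ∫⁻ x, ENNReal.ofReal (klFun (F x / G x)) ∂ν := by
        rw [hratio, klDiv_eq_lintegral_klFun_of_ac (withDensity_absolutelyContinuous _ _)]
        refine lintegral_congr_ae ?_
        filter_upwards [Measure.rnDeriv_withDensity ν
          (f := fun x ↦ ENNReal.ofReal (F x / G x)) (by fun_prop)] with x hx
        rw [hx, ENNReal.toReal_ofReal (div_nonneg (hF0 x) (hG0 x).le)]
    _ = _ := by
        rw [hν, lintegral_withDensity_eq_lintegral_mul _ (by fun_prop) (by fun_prop)]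
        refine lintegral_congr fun x ↦ ?_
        rw [Pi.mul_apply, ENNReal.ofReal_mul (hG0 x).le]

end KLBounds

section NoiseContraction

open InformationTheory

lemma isFiniteMeasure_withDensity_of_forall_le {Ω : Type*} [MeasurableSpace Ω] {μ : Measure Ω}
    [IsFiniteMeasure μ] {F : Ω → ℝ} {C : ℝ} (hC : ∀ x, F x ≤ C) :
    IsFiniteMeasure (μ.withDensity fun x ↦ ENNReal.ofReal (F x)) := by
  refine isFiniteMeasure_withDensity (ne_of_lt ?_)
  calc ∫⁻ x, ENNReal.ofReal (F x) ∂μ ≤ ∫⁻ _, ENNReal.ofReal C ∂μ :=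
        lintegral_mono fun x ↦ ENNReal.ofReal_le_ofReal (hC x)
    _ < ∞ := by
        rw [lintegral_const]
        exact ENNReal.mul_lt_top ENNReal.ofReal_lt_top (measure_lt_top _ _)

lemma exp_mul_le_one_add_mul_exp {θ : ℝ} (h0 : 0 ≤ θ) (h1 : θ ≤ 1) (s : ℝ) :
    Real.exp (θ * s) ≤ 1 + θ * Real.exp s := by
  have hconv := convexOn_exp.2 (Set.mem_univ s) (Set.mem_univ 0) h0 (sub_nonneg.2 h1)
    (add_sub_cancel θ 1)
  simp only [smul_eq_mul, mul_zero, add_zero, Real.exp_zero, mul_one] at hconv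
  linarith

lemma exists_small_parameter {κ r m B δ : ℝ} (h : κ * r < 1) (hδ : 0 < δ) :
    ∃ η : ℝ, 0 < η ∧ η ≤ δ ∧ η * m < 1 ∧
      κ * ((1 + η) ^ 2 / (1 - η * m) * (r + η / δ * B)) ≤ 1 := by
  have hcont : ContinuousAt (fun η : ℝ ↦
      κ * ((1 + η) ^ 2 / (1 - η * m) * (r + η / δ * B))) 0 := by
    have : (1 - (0 : ℝ) * m) ≠ 0 := by simp
    fun_prop (disch := assumption)
  have hlim : ∀ᶠ η in nhds (0 : ℝ), κ * ((1 + η) ^ 2 / (1 - η * m) * (r + η / δ * B)) < 1 :=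
    hcont.eventually_lt_const (by simpa using h)
  have hm : ∀ᶠ η in nhds (0 : ℝ), η * m < 1 :=
    (continuous_mul_const m).continuousAt.eventually_lt_const (by simp)
  obtain ⟨η, ⟨⟨hlim, hm⟩, hle⟩, hη⟩ :=
    ((((hlim.and hm).and (eventually_lt_nhds hδ)).filter_mono nhdsWithin_le_nhds).and
      (self_mem_nhdsWithin (s := Set.Ioi (0 : ℝ)))).exists
  exact ⟨η, hη, hle.le, hm, hlim.le⟩

lemma lintegral_ofReal_sq_mul_exp_le {E : Type*} [NormedAddCommGroup E] [MeasurableSpace E]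
    {μ : Measure E} {P : E → ℝ} {c η δ : ℝ} (hc : 0 ≤ c) (hη : 0 ≤ η) (hδ : 0 < δ) (hηδ : η ≤ δ)
    (hP : Integrable (fun x ↦ P x ^ 2) μ)
    (hPexp : Integrable (fun x ↦ P x ^ 2 * Real.exp (δ * ‖x‖ ^ 2)) μ) :
    ∫⁻ x, ENNReal.ofReal (c * (P x ^ 2 * Real.exp (η * ‖x‖ ^ 2))) ∂μ ≤
      ENNReal.ofReal (c * (∫ x, P x ^ 2 ∂μ +
        η / δ * ∫ x, P x ^ 2 * Real.exp (δ * ‖x‖ ^ 2) ∂μ)) := by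
  have hθ : 0 ≤ η / δ := by positivity
  rw [← integral_const_mul (η / δ), ← integral_add hP (hPexp.const_mul _), ← integral_const_mul,
    ofReal_integral_eq_lintegral_ofReal ((hP.fun_add (hPexp.const_mul _)).const_mul _)
      (ae_of_all _ fun x ↦ by positivity)]
  refine lintegral_mono fun x ↦ ENNReal.ofReal_le_ofReal ?_
  have hexp := exp_mul_le_one_add_mul_exp hθ ((div_le_one hδ).2 hηδ) (δ * ‖x‖ ^ 2)
  rw [← mul_assoc, div_mul_cancel₀ _ hδ.ne'] at hexp
  grw [hexp]
  exact le_of_eq (by ring)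

/-- A density, with respect to the standard Gaussian measure, that is close to `1`: at most
`1 + η`, and at least `(1 + η)⁻¹` up to a Gaussian factor. -/
structure IsPinched {E : Type*} [NormedAddCommGroup E] [MeasurableSpace E] (η : ℝ)
    (F : E → ℝ) : Prop where
  measurable : Measurable F
  lower : ∀ x, (1 + η)⁻¹ * Real.exp (-η * ‖x‖ ^ 2) ≤ F x
  upper : ∀ x, F x ≤ 1 + η

namespace IsPinched

variable {E : Type*} [NormedAddCommGroup E] [MeasurableSpace E] {η : ℝ} {F G : E → ℝ}

lemma pos (hη : 0 < η) (hF : IsPinched η F) (x : E) : 0 < F x :=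
  lt_of_lt_of_le (by positivity) (hF.lower x)

lemma abs_le (hη : 0 < η) (hF : IsPinched η F) (x : E) : |F x| ≤ 1 + η := by
  rw [abs_of_pos (hF.pos hη x)]
  exact hF.upper x

lemma abs_sub_le (hη : 0 < η) (hF : IsPinched η F) (hG : IsPinched η G) (x : E) :
    |F x - G x| ≤ 1 + η := by
  rw [_root_.abs_le]
  constructor <;> linarith [hF.pos hη x, hG.pos hη x, hF.upper x, hG.upper x]

end IsPinched

variable {E : Type*} [NormedAddCommGroup E] [InnerProductSpace ℝ E] [FiniteDimensional ℝ E]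
  [MeasurableSpace E] [BorelSpace E]

/-- The law of `ρ X + √(1-ρ²) W` for `X` of law `μ` and `W` an independent standard Gaussian. -/
noncomputable def ouMeasure (ρ : ℝ) (μ : Measure E) : Measure E :=
  (μ.map (fun x ↦ ρ • x)).conv ((stdGaussian E).map (fun x ↦ √(1 - ρ ^ 2) • x))

lemma ouMeasure_withDensity {ρ C : ℝ} (h0 : 0 ≤ ρ) (h1 : ρ ≤ 1) {F : E → ℝ} (hF : Measurable F)
    (hF0 : ∀ x, 0 ≤ F x) (hC : ∀ x, |F x| ≤ C) :
    ouMeasure ρ ((stdGaussian E).withDensity fun x ↦ ENNReal.ofReal (F x)) =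
      (stdGaussian E).withDensity fun x ↦ ENNReal.ofReal (ouOperator ρ F x) := by
  have : IsProbabilityMeasure ((stdGaussian E).map fun x ↦ √(1 - ρ ^ 2) • x) :=
    Measure.isProbabilityMeasure_map (by fun_prop)
  have hP := measurable_ouOperator (t := ρ) hF
  refine Measure.ext_of_lintegral _ fun f hf ↦ ?_
  calc ∫⁻ x, f x ∂(ouMeasure ρ ((stdGaussian E).withDensity fun x ↦ ENNReal.ofReal (F x)))
      = ∫⁻ x, ∫⁻ w, ENNReal.ofReal (F x) * f (ρ • x + √(1 - ρ ^ 2) • w) ∂(stdGaussian E)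
          ∂(stdGaussian E) := by
        rw [ouMeasure, Measure.lintegral_conv hf, lintegral_map (by fun_prop) (by fun_prop),
          lintegral_withDensity_eq_lintegral_mul _ (by fun_prop) (by fun_prop)]
        refine lintegral_congr fun x ↦ ?_
        rw [Pi.mul_apply, lintegral_map (by fun_prop) (by fun_prop),
          lintegral_const_mul _ (by fun_prop)]
    _ = ∫⁻ x, ∫⁻ w, ENNReal.ofReal (F (ρ • x + √(1 - ρ ^ 2) • w)) * f x ∂(stdGaussian E)
          ∂(stdGaussian E) :=
        lintegral_mul_comp_smul_add_smul_comm (sq_add_sqrt_one_sub_sq h0 h1)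
          (f := fun x ↦ ENNReal.ofReal (F x)) (by fun_prop) hf
    _ = ∫⁻ x, ENNReal.ofReal (ouOperator ρ F x) * f x ∂(stdGaussian E) := by
        refine lintegral_congr fun x ↦ ?_
        rw [lintegral_mul_const _ (by fun_prop), ouOperator, ofReal_integral_eq_lintegral_ofReal
          (integrable_of_forall_abs_le (by fun_prop) fun w ↦ hC _) (ae_of_all _ fun w ↦ hF0 _)]
    _ = _ := by
        rw [lintegral_withDensity_eq_lintegral_mul _ (by fun_prop) hf]
        rfl

lemma ouOperator_sub {ρ A B : ℝ} {F G : E → ℝ} (hF : Measurable F) (hG : Measurable G)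
    (hA : ∀ x, |F x| ≤ A) (hB : ∀ x, |G x| ≤ B) (x : E) :
    ouOperator ρ (fun x ↦ F x - G x) x = ouOperator ρ F x - ouOperator ρ G x :=
  integral_sub (integrable_of_forall_abs_le (by fun_prop) fun w ↦ hA _)
    (integrable_of_forall_abs_le (by fun_prop) fun w ↦ hB _)

lemma norm_sq_smul_add_smul_le {F : Type*} [SeminormedAddCommGroup F] [InnerProductSpace ℝ F]
    {t σ : ℝ} (h : t ^ 2 + σ ^ 2 = 1) (x w : F) :
    ‖t • x + σ • w‖ ^ 2 ≤ ‖x‖ ^ 2 + ‖w‖ ^ 2 := by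
  have hadd : ‖t • x + σ • w‖ ^ 2 + ‖σ • x - t • w‖ ^ 2 =
      (t ^ 2 + σ ^ 2) * (‖x‖ ^ 2 + ‖w‖ ^ 2) := by
    simp only [norm_add_sq_real, norm_sub_sq_real, norm_smul, inner_smul_left, inner_smul_right,
      mul_pow, Real.norm_eq_abs, sq_abs, conj_trivial]
    ring
  rw [h, one_mul] at hadd
  linarith [sq_nonneg ‖σ • x - t • w‖]

lemma le_ouOperator_of_exp_le {ρ η m C : ℝ} (h0 : 0 ≤ ρ) (h1 : ρ ≤ 1) (hη : 0 ≤ η) (hm : 0 ≤ m)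
    {F : E → ℝ} (hF : Measurable F) (hC : ∀ x, |F x| ≤ C)
    (hl : ∀ x, m * Real.exp (-η * ‖x‖ ^ 2) ≤ F x) (x : E) :
    m * (1 - η * ∫ w, ‖w‖ ^ 2 ∂(stdGaussian E)) * Real.exp (-η * ‖x‖ ^ 2) ≤
      ouOperator ρ F x := by
  have hsq := integrable_norm_sq_stdGaussian (E := E)
  have hlower : m * (1 - η * ∫ w, ‖w‖ ^ 2 ∂(stdGaussian E)) * Real.exp (-η * ‖x‖ ^ 2) =
      ∫ w, m * Real.exp (-η * ‖x‖ ^ 2) * (1 - η * ‖w‖ ^ 2) ∂(stdGaussian E) := by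
    rw [integral_const_mul, integral_sub (integrable_const _) (hsq.const_mul _),
      integral_const_mul, integral_const, probReal_univ, one_smul]
    ring
  rw [hlower]
  refine integral_mono (((integrable_const _).sub (hsq.const_mul _)).const_mul _)
    (integrable_of_forall_abs_le (by fun_prop) fun w ↦ hC _) fun w ↦ ?_
  calc m * Real.exp (-η * ‖x‖ ^ 2) * (1 - η * ‖w‖ ^ 2)
      ≤ m * Real.exp (-η * ‖x‖ ^ 2) * Real.exp (-(η * ‖w‖ ^ 2)) := by
        gcongr
        exact Real.one_sub_le_exp_neg _
    _ = m * Real.exp (-η * (‖x‖ ^ 2 + ‖w‖ ^ 2)) := by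
        rw [mul_assoc, ← Real.exp_add]
        ring_nf
    _ ≤ m * Real.exp (-η * ‖ρ • x + √(1 - ρ ^ 2) • w‖ ^ 2) := by
        gcongr m * Real.exp ?_
        exact mul_le_mul_of_nonpos_left
          (norm_sq_smul_add_smul_le (sq_add_sqrt_one_sub_sq h0 h1) x w) (neg_nonpos.2 hη)
    _ ≤ F (ρ • x + √(1 - ρ ^ 2) • w) := hl _

namespace IsPinched

variable {η : ℝ} {F G : E → ℝ}

lemma isFiniteMeasure_withDensity (hF : IsPinched η F) :
    IsFiniteMeasure ((stdGaussian E).withDensity fun x ↦ ENNReal.ofReal (F x)) :=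
  isFiniteMeasure_withDensity_of_forall_le hF.upper

lemma le_klDiv (hη : 0 < η) (hF : IsPinched η F) (hG : IsPinched η G) :
    ENNReal.ofReal ((2 * (1 + η))⁻¹ * ∫ x, (F x - G x) ^ 2 ∂(stdGaussian E)) ≤
      klDiv ((stdGaussian E).withDensity fun x ↦ ENNReal.ofReal (F x))
        ((stdGaussian E).withDensity fun x ↦ ENNReal.ofReal (G x)) := by
  have := hF.isFiniteMeasure_withDensity
  have := hG.isFiniteMeasure_withDensity
  have hsq : Integrable (fun x ↦ (F x - G x) ^ 2) (stdGaussian E) :=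
    (memLp_of_forall_abs_le (hF.measurable.sub hG.measurable)
      (hF.abs_sub_le hη hG)).integrable_sq
  rw [klDiv_withDensity_withDensity hF.measurable hG.measurable (fun x ↦ (hF.pos hη x).le)
    (hG.pos hη), ← integral_const_mul, ofReal_integral_eq_lintegral_ofReal (hsq.const_mul _)
    (ae_of_all _ fun x ↦ by positivity)]
  refine lintegral_mono fun x ↦ ENNReal.ofReal_le_ofReal ?_
  rw [← div_eq_inv_mul]
  exact sq_sub_div_le_mul_klFun_div (hF.pos hη x) (hG.pos hη x) (hF.upper x) (hG.upper x)

lemma klDiv_ouMeasure_le {ρ : ℝ} (h0 : 0 ≤ ρ) (h1 : ρ ≤ 1) (hη : 0 < η)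
    (hηm : η * ∫ w, ‖w‖ ^ 2 ∂(stdGaussian E) < 1) (hF : IsPinched η F) (hG : IsPinched η G) :
    klDiv (ouMeasure ρ ((stdGaussian E).withDensity fun x ↦ ENNReal.ofReal (F x)))
        (ouMeasure ρ ((stdGaussian E).withDensity fun x ↦ ENNReal.ofReal (G x))) ≤
      ∫⁻ x, ENNReal.ofReal ((1 + η) / (2 * (1 - η * ∫ w, ‖w‖ ^ 2 ∂(stdGaussian E))) *
        (ouOperator ρ (fun x ↦ F x - G x) x ^ 2 * Real.exp (η * ‖x‖ ^ 2))) ∂(stdGaussian E) := by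
  set m := ∫ w, ‖w‖ ^ 2 ∂(stdGaussian E)
  have hm : 0 < 1 - η * m := sub_pos.2 hηm
  have hpos (x : E) : 0 < (1 + η)⁻¹ * (1 - η * m) * Real.exp (-η * ‖x‖ ^ 2) := by positivity
  have hlower {H : E → ℝ} (hH : IsPinched η H) :=
    le_ouOperator_of_exp_le h0 h1 hη.le (by positivity) hH.measurable (hH.abs_le hη) hH.lower
  have hfin {H : E → ℝ} (hH : IsPinched η H) :
      IsFiniteMeasure ((stdGaussian E).withDensity fun x ↦ ENNReal.ofReal (ouOperator ρ H x)) :=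
    isFiniteMeasure_withDensity_of_forall_le fun x ↦
      (le_abs_self _).trans (abs_ouOperator_le (hH.abs_le hη) x)
  have := hfin hF
  have := hfin hG
  rw [ouMeasure_withDensity h0 h1 hF.measurable (fun x ↦ (hF.pos hη x).le) (hF.abs_le hη),
    ouMeasure_withDensity h0 h1 hG.measurable (fun x ↦ (hG.pos hη x).le) (hG.abs_le hη),
    klDiv_withDensity_withDensity (measurable_ouOperator hF.measurable)
      (measurable_ouOperator hG.measurable) (fun x ↦ ((hpos x).trans_le (hlower hF x)).le)
      (fun x ↦ (hpos x).trans_le (hlower hG x))]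
  refine lintegral_mono fun x ↦ ENNReal.ofReal_le_ofReal ?_
  refine (mul_klFun_div_le_sq_sub_div (hpos x) (hlower hF x) (hlower hG x)).trans_eq ?_
  rw [ouOperator_sub hF.measurable hG.measurable (hF.abs_le hη) (hG.abs_le hη), neg_mul,
    Real.exp_neg]
  field_simp

end IsPinched

lemma exists_klDiv_ouMeasure_le (E : Type*) [NormedAddCommGroup E] [InnerProductSpace ℝ E]
    [FiniteDimensional ℝ E] [MeasurableSpace E] [BorelSpace E] {ρ κ : ℝ} (h0 : 0 < ρ) (h1 : ρ < 1)
    (hκ : 0 ≤ κ) (hκρ : κ * ρ ^ 6 < 1) :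
    ∃ η : ℝ, 0 < η ∧ ∀ F G : E → ℝ, IsPinched η F → IsPinched η G →
      OrthQuadratic (fun x ↦ F x - G x) →
      ENNReal.ofReal κ *
        klDiv (ouMeasure ρ ((stdGaussian E).withDensity fun x ↦ ENNReal.ofReal (F x)))
          (ouMeasure ρ ((stdGaussian E).withDensity fun x ↦ ENNReal.ofReal (G x))) ≤
        klDiv ((stdGaussian E).withDensity fun x ↦ ENNReal.ofReal (F x))
          ((stdGaussian E).withDensity fun x ↦ ENNReal.ofReal (G x)) := by
  obtain ⟨δ, B, hδ, hweighted⟩ := exists_integral_ouOperator_sq_mul_exp_le E h0.le h1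
  set m := ∫ w, ‖w‖ ^ 2 ∂(stdGaussian E)
  obtain ⟨η, hη, hηδ, hηm, hηκ⟩ := exists_small_parameter (m := m) (B := B) hκρ hδ
  refine ⟨η, hη, fun F G hF hG horth ↦ ?_⟩
  have hψ : Measurable fun x ↦ F x - G x := hF.measurable.sub hG.measurable
  have hψC := hF.abs_sub_le hη hG
  obtain ⟨hint, hle⟩ := hweighted _ hψ (memLp_of_forall_abs_le hψ hψC)
  have hsq : Integrable (fun x ↦ ouOperator ρ (fun x ↦ F x - G x) x ^ 2) (stdGaussian E) :=
    (memLp_of_forall_abs_le (measurable_ouOperator hψ) (abs_ouOperator_le hψC)).integrable_sq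
  set S := ∫ x, (F x - G x) ^ 2 ∂(stdGaussian E)
  set c := (1 + η) / (2 * (1 - η * m)) with hc
  have hc0 : 0 ≤ c := div_nonneg (by positivity) (mul_nonneg two_pos.le (sub_pos.2 hηm).le)
  have hout : klDiv (ouMeasure ρ ((stdGaussian E).withDensity fun x ↦ ENNReal.ofReal (F x)))
      (ouMeasure ρ ((stdGaussian E).withDensity fun x ↦ ENNReal.ofReal (G x))) ≤
      ENNReal.ofReal (c * ((ρ ^ 6 + η / δ * B) * S)) := by
    grw [hF.klDiv_ouMeasure_le h0.le h1.le hη hηm hG,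
      lintegral_ofReal_sq_mul_exp_le hc0 hη.le hδ hηδ hsq hint, hle,
      horth.integral_ouOperator_sq_le hψ hψC h0 h1, add_mul, mul_assoc (η / δ)]
  calc ENNReal.ofReal κ * klDiv (ouMeasure ρ _) (ouMeasure ρ _)
      ≤ ENNReal.ofReal (κ * (c * ((ρ ^ 6 + η / δ * B) * S))) := by
        grw [hout, ENNReal.ofReal_mul hκ]
    _ = ENNReal.ofReal (κ * ((1 + η) ^ 2 / (1 - η * m) * (ρ ^ 6 + η / δ * B)) *
          ((2 * (1 + η))⁻¹ * S)) := by
        rw [hc]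
        field_simp
    _ ≤ ENNReal.ofReal ((2 * (1 + η))⁻¹ * S) := by
        have : 0 ≤ S := integral_nonneg fun x ↦ sq_nonneg _
        exact ENNReal.ofReal_le_ofReal (mul_le_of_le_one_left (by positivity) hηκ)
    _ ≤ _ := hF.le_klDiv hη hG

end NoiseContraction

section GaussianMatrix

open Matrix WithLp
open scoped MatrixOrder

lemma transpose_eq_of_nonneg {ι : Type*} {S : Matrix ι ι ℝ} (hS : 0 ≤ S) : Sᵀ = S := by
  simpa using (nonneg_iff_posSemidef.1 hS).1.eq

variable {ι : Type*} [Fintype ι]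

lemma norm_sq_eq_dotProduct (x : EuclideanSpace ℝ ι) : ‖x‖ ^ 2 = ofLp x ⬝ᵥ ofLp x := by
  rw [EuclideanSpace.real_norm_sq_eq]
  simp only [dotProduct, pow_two]

lemma dotProduct_mulVec_le_of_le {A B : Matrix ι ι ℝ} (h : A ≤ B) (v : ι → ℝ) :
    v ⬝ᵥ A *ᵥ v ≤ v ⬝ᵥ B *ᵥ v := by
  simpa [sub_mulVec] using (le_iff.1 h).dotProduct_mulVec_nonneg v

variable [DecidableEq ι]

lemma inner_toEuclideanCLM_left (M : Matrix ι ι ℝ) (x y : EuclideanSpace ℝ ι) :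
    inner ℝ (toEuclideanCLM (𝕜 := ℝ) M x) y = inner ℝ x (toEuclideanCLM (𝕜 := ℝ) Mᵀ y) := by
  rw [real_inner_comm, inner_toEuclideanCLM, inner_toEuclideanCLM, mulVec_transpose,
    dotProduct_mulVec, dotProduct_comm]

lemma lintegral_comp_toEuclideanCLM {M : Matrix ι ι ℝ} (hM : M.det ≠ 0)
    {f : EuclideanSpace ℝ ι → ℝ≥0∞} (hf : Measurable f) :
    ∫⁻ x, f (toEuclideanCLM (𝕜 := ℝ) M x) = ENNReal.ofReal |M.det⁻¹| * ∫⁻ x, f x := by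
  have hdet : LinearMap.det (toEuclideanCLM (𝕜 := ℝ) M).toLinearMap = M.det := by
    rw [coe_toEuclideanCLM_eq_toEuclideanLin]
    exact LinearMap.det_toLin (PiLp.basisFun 2 ℝ ι) M
  have hmap := Measure.map_linearMap_addHaar_eq_smul_addHaar
    (volume : Measure (EuclideanSpace ℝ ι)) (hdet ▸ hM)
  rw [hdet] at hmap
  rw [← smul_eq_mul, ← lintegral_smul_measure, ← hmap]
  exact (lintegral_map hf (toEuclideanCLM (𝕜 := ℝ) M).continuous.measurable).symm

lemma map_toEuclideanCLM_multivariateGaussian_zero {S : Matrix ι ι ℝ} (hS : S.PosSemidef)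
    (M : Matrix ι ι ℝ) :
    (multivariateGaussian 0 S).map (toEuclideanCLM (𝕜 := ℝ) M)
      = multivariateGaussian 0 (M * S * Mᵀ) := by
  have hMSM : (M * S * Mᵀ).PosSemidef := by
    simpa using hS.mul_mul_conjTranspose_same M
  have : IsProbabilityMeasure ((multivariateGaussian 0 S).map (toEuclideanCLM (𝕜 := ℝ) M)) :=
    Measure.isProbabilityMeasure_map (by fun_prop)
  refine Measure.ext_of_charFun (funext fun t ↦ ?_)
  rw [charFun_multivariateGaussian hMSM, charFun_apply,
    integral_map (by fun_prop) (by fun_prop)]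
  simp_rw [inner_toEuclideanCLM_left]
  rw [← charFun_apply, charFun_multivariateGaussian hS]
  simp only [inner_zero_right, ofLp_toEuclideanCLM]
  congr 4
  rw [← mulVec_mulVec, ← mulVec_mulVec, dotProduct_mulVec _ M, ← mulVec_transpose]

lemma multivariateGaussian_conv_multivariateGaussian {m m' : EuclideanSpace ℝ ι}
    {S S' : Matrix ι ι ℝ} (hS : S.PosSemidef) (hS' : S'.PosSemidef) :
    (multivariateGaussian m S).conv (multivariateGaussian m' S')
      = multivariateGaussian (m + m') (S + S') := by
  refine Measure.ext_of_charFun (funext fun t ↦ ?_)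
  rw [charFun_conv, charFun_multivariateGaussian hS, charFun_multivariateGaussian hS',
    charFun_multivariateGaussian (hS.add hS'), ← Complex.exp_add]
  simp only [inner_add_right, add_mulVec, dotProduct_add]
  push_cast
  ring_nf

/-- The Lebesgue density of the Gaussian measure with mean `m` and covariance matrix `S`, which is
assumed to be invertible. -/
noncomputable def gaussianDensity (m : EuclideanSpace ℝ ι) (S : Matrix ι ι ℝ)
    (x : EuclideanSpace ℝ ι) : ℝ :=
  (√S.det)⁻¹ * ((2 * Real.pi) ^ (-(Fintype.card ι / 2 : ℝ)) *
    Real.exp (-(ofLp (x - m) ⬝ᵥ S⁻¹ *ᵥ ofLp (x - m)) / 2))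

lemma gaussianDensity_pos (m : EuclideanSpace ℝ ι) {S : Matrix ι ι ℝ}
    (hS : S.PosDef) (x : EuclideanSpace ℝ ι) : 0 < gaussianDensity m S x := by
  have := hS.det_pos
  unfold gaussianDensity
  positivity

lemma measurable_gaussianDensity (m : EuclideanSpace ℝ ι) (S : Matrix ι ι ℝ) :
    Measurable (gaussianDensity m S) := by
  unfold gaussianDensity
  simp only [← inner_toEuclideanCLM]
  fun_prop

lemma det_cfcSqrt_pos {S : Matrix ι ι ℝ} (hS : S.PosDef) : 0 < (CFC.sqrt S).det := by
  simpa [hS.posSemidef.det_sqrt] using hS.det_pos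

lemma stdGaussianPDF_eq_det_mul_gaussianDensity (m : EuclideanSpace ℝ ι) {S : Matrix ι ι ℝ}
    (hS : S.PosDef) (x : EuclideanSpace ℝ ι) :
    stdGaussianPDF _ x = (CFC.sqrt S).det *
      gaussianDensity m S (m + toEuclideanCLM (𝕜 := ℝ) (CFC.sqrt S) x) := by
  have hdet := det_cfcSqrt_pos hS
  have hunit := hdet.ne'.isUnit
  have hS_inv : (CFC.sqrt S)ᵀ * S⁻¹ * CFC.sqrt S = 1 := by
    nth_rw 2 [← CFC.sqrt_mul_sqrt_self S hS.posSemidef.nonneg]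
    rw [transpose_eq_of_nonneg (CFC.sqrt_nonneg _), Matrix.mul_inv_rev, ← Matrix.mul_assoc,
      mul_nonsing_inv _ hunit, Matrix.one_mul, nonsing_inv_mul _ hunit]
  have hquad : (CFC.sqrt S *ᵥ ofLp x) ⬝ᵥ S⁻¹ *ᵥ (CFC.sqrt S *ᵥ ofLp x) = ‖x‖ ^ 2 := by
    rw [norm_sq_eq_dotProduct, ← vecMul_transpose (CFC.sqrt S), ← dotProduct_mulVec,
      vecMul_transpose, mulVec_mulVec, mulVec_mulVec, hS_inv, one_mulVec]
  rw [gaussianDensity, add_sub_cancel_left, ofLp_toEuclideanCLM, hquad, stdGaussianPDF,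
    show √S.det = (CFC.sqrt S).det by simp [hS.posSemidef.det_sqrt],
    mul_inv_cancel_left₀ hdet.ne', finrank_euclideanSpace]

lemma multivariateGaussian_eq_withDensity (m : EuclideanSpace ℝ ι) {S : Matrix ι ι ℝ}
    (hS : S.PosDef) :
    multivariateGaussian m S
      = volume.withDensity (fun x ↦ ENNReal.ofReal (gaussianDensity m S x)) := by
  have hdet := det_cfcSqrt_pos hS
  have hgm := measurable_gaussianDensity m S
  have hsm := measurable_stdGaussianPDF (E := EuclideanSpace ℝ ι)
  refine Measure.ext_of_lintegral _ fun f hf ↦ ?_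
  rw [multivariateGaussian, lintegral_map hf (by fun_prop), stdGaussian_eq_withDensity,
    lintegral_withDensity_eq_lintegral_mul _ (by fun_prop) (by fun_prop),
    lintegral_withDensity_eq_lintegral_mul _ (by fun_prop) (by fun_prop)]
  simp only [Pi.mul_apply, stdGaussianPDF_eq_det_mul_gaussianDensity m hS,
    ENNReal.ofReal_mul hdet.le, mul_assoc]
  rw [lintegral_const_mul _ (by fun_prop),
    lintegral_comp_toEuclideanCLM hdet.ne'
      (f := fun y ↦ ENNReal.ofReal (gaussianDensity m S (m + y)) * f (m + y)) (by fun_prop),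
    abs_of_pos (inv_pos.2 hdet), ← mul_assoc, ← ENNReal.ofReal_mul hdet.le,
    mul_inv_cancel₀ hdet.ne', ENNReal.ofReal_one, one_mul]
  exact lintegral_add_left_eq_self (fun y ↦ ENNReal.ofReal (gaussianDensity m S y) * f y) m

lemma one_le_det {S : Matrix ι ι ℝ} (h : 1 ≤ S) : 1 ≤ S.det := by
  have hS : S.PosSemidef := nonneg_iff_posSemidef.1 (zero_le_one.trans h)
  rw [hS.1.det_eq_prod_eigenvalues]
  rw [← map_one (algebraMap ℝ (Matrix ι ι ℝ)), algebraMap_le_iff_le_spectrum] at h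
  exact Finset.one_le_prod fun i _ ↦ h _ (hS.1.eigenvalues_mem_spectrum_real i)

lemma det_le_det {A B : Matrix ι ι ℝ} (hA : A.PosDef) (h : A ≤ B) : A.det ≤ B.det := by
  set R := CFC.sqrt A
  have hRA : R * R = A := CFC.sqrt_mul_sqrt_self A hA.posSemidef.nonneg
  have hunit : IsUnit R.det := (det_cfcSqrt_pos hA).ne'.isUnit
  have hstar : star R⁻¹ = R⁻¹ := by
    rw [star_eq_conjTranspose, conjTranspose_eq_transpose_of_trivial, transpose_nonsing_inv,
      transpose_eq_of_nonneg (CFC.sqrt_nonneg _)]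
  have hone : 1 ≤ R⁻¹ * B * R⁻¹ := by
    calc 1 = star R⁻¹ * A * R⁻¹ := by
          rw [hstar, ← hRA, ← Matrix.mul_assoc, nonsing_inv_mul _ hunit, Matrix.one_mul,
            mul_nonsing_inv _ hunit]
      _ ≤ star R⁻¹ * B * R⁻¹ := star_left_conjugate_le_conjugate h _
      _ = R⁻¹ * B * R⁻¹ := by rw [hstar]
  have hdet := one_le_det hone
  rw [det_mul, det_mul, mul_right_comm, ← det_mul, ← Matrix.mul_inv_rev, hRA] at hdet
  have := hA.det_pos
  rwa [det_nonsing_inv, Ring.inverse_eq_inv', ← div_eq_inv_mul, one_le_div this] at hdet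

lemma inv_le_inv_of_le {A B : Matrix ι ι ℝ} (hA : A.PosDef) (h : A ≤ B) : B⁻¹ ≤ A⁻¹ := by
  have hB : B.PosDef := by simpa using hA.add_posSemidef (le_iff.1 h)
  have := hA.inv.isUnit.invertible
  have := hB.isUnit.invertible
  have hblocks := PosDef.fromBlocks₁₁ 1 A⁻¹ hB
  rw [PosDef.fromBlocks₂₂ B 1 hA.inv] at hblocks
  simpa [le_iff, hA.det_pos.ne'] using hblocks.1 (by simpa [hA.det_pos.ne', le_iff] using h)

lemma norm_sq_le_dotProduct_inv_mulVec {S : Matrix ι ι ℝ} {c : ℝ} (hc : 0 < c)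
    (hcS : c • 1 ≤ S) (hS1 : S ≤ 1) (x : EuclideanSpace ℝ ι) :
    ‖x‖ ^ 2 ≤ ofLp x ⬝ᵥ S⁻¹ *ᵥ ofLp x ∧ ofLp x ⬝ᵥ S⁻¹ *ᵥ ofLp x ≤ c⁻¹ * ‖x‖ ^ 2 := by
  have hc1 : (c • (1 : Matrix ι ι ℝ)).PosDef := PosDef.one.smul hc
  have hS : S.PosDef := by simpa using hc1.add_posSemidef (le_iff.1 hcS)
  have hinv : (c • (1 : Matrix ι ι ℝ))⁻¹ = c⁻¹ • 1 := inv_eq_right_inv (by simp [hc.ne'])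
  have hlow := dotProduct_mulVec_le_of_le (inv_le_inv_of_le hS hS1) (ofLp x)
  have hup := dotProduct_mulVec_le_of_le (inv_le_inv_of_le hc1 hcS) (ofLp x)
  rw [norm_sq_eq_dotProduct]
  simp only [hinv, inv_one, one_mulVec, smul_mulVec, dotProduct_smul, smul_eq_mul] at hlow hup
  exact ⟨hlow, hup⟩

lemma gaussianDensity_zero_div_stdGaussianPDF (S : Matrix ι ι ℝ) (x : EuclideanSpace ℝ ι) :
    gaussianDensity 0 S x / stdGaussianPDF _ x =
      (√S.det)⁻¹ * Real.exp (-(ofLp x ⬝ᵥ S⁻¹ *ᵥ ofLp x - ‖x‖ ^ 2) / 2) := by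
  have hexp : -(ofLp x ⬝ᵥ S⁻¹ *ᵥ ofLp x - ‖x‖ ^ 2) / 2 =
      -(ofLp x ⬝ᵥ S⁻¹ *ᵥ ofLp x) / 2 - -‖x‖ ^ 2 / 2 := by ring
  have : (0 : ℝ) < (2 * Real.pi) ^ (-(Fintype.card ι / 2 : ℝ)) := by positivity
  rw [gaussianDensity, stdGaussianPDF, finrank_euclideanSpace, sub_zero, hexp, Real.exp_sub]
  field_simp

lemma exists_density_multivariateGaussian {S : Matrix ι ι ℝ} {c : ℝ} (hc : 0 < c)
    (hcS : c • 1 ≤ S) (hS1 : S ≤ 1) :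
    ∃ G : EuclideanSpace ℝ ι → ℝ, Measurable G ∧
      multivariateGaussian 0 S = (stdGaussian _).withDensity (fun x ↦ ENNReal.ofReal (G x)) ∧
      ∀ x, Real.exp (-((c⁻¹ - 1) / 2) * ‖x‖ ^ 2) ≤ G x ∧
        G x ≤ (√(c ^ Fintype.card ι))⁻¹ := by
  have hS : S.PosDef := by
    simpa using (PosDef.one.smul hc).add_posSemidef (le_iff.1 hcS)
  have hgm := measurable_gaussianDensity 0 S
  have hsm := measurable_stdGaussianPDF (E := EuclideanSpace ℝ ι)
  refine ⟨fun x ↦ gaussianDensity 0 S x / stdGaussianPDF _ x, by fun_prop, ?_, fun x ↦ ?_⟩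
  · rw [multivariateGaussian_eq_withDensity 0 hS, stdGaussian_eq_withDensity,
      ← withDensity_mul _ (by fun_prop) (by fun_prop)]
    congr 1
    ext x
    rw [Pi.mul_apply, ← ENNReal.ofReal_mul (stdGaussianPDF_pos x).le,
      mul_div_cancel₀ _ (stdGaussianPDF_pos x).ne']
  simp only [gaussianDensity_zero_div_stdGaussianPDF]
  obtain ⟨hlow, hup⟩ := norm_sq_le_dotProduct_inv_mulVec hc hcS hS1 x
  have hdet1 : √S.det ≤ 1 := Real.sqrt_le_one.2 (by simpa using det_le_det hS hS1)
  have hdetc : √(c ^ Fintype.card ι) ≤ √S.det :=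
    Real.sqrt_le_sqrt (by simpa [det_smul] using det_le_det (PosDef.one.smul hc) hcS)
  have hdet0 : 0 < √S.det := Real.sqrt_pos.2 hS.det_pos
  constructor
  · calc Real.exp (-((c⁻¹ - 1) / 2) * ‖x‖ ^ 2)
        ≤ Real.exp (-(ofLp x ⬝ᵥ S⁻¹ *ᵥ ofLp x - ‖x‖ ^ 2) / 2) :=
          Real.exp_le_exp.2 (by linarith)
      _ ≤ _ := le_mul_of_one_le_left (Real.exp_pos _).le ((one_le_inv₀ hdet0).2 hdet1)
  · calc (√S.det)⁻¹ * Real.exp (-(ofLp x ⬝ᵥ S⁻¹ *ᵥ ofLp x - ‖x‖ ^ 2) / 2)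
        ≤ (√S.det)⁻¹ :=
          mul_le_of_le_one_right (by positivity) (Real.exp_le_one_iff.2 (by linarith))
      _ ≤ (√(c ^ Fintype.card ι))⁻¹ := inv_anti₀ (by positivity) hdetc

end GaussianMatrix

section Entropy

open Matrix WithLp InformationTheory

lemma coe_ennreal_sub_eq_of_add_eq_add {a b p n k : ℝ≥0∞} (ha : a ≠ ∞) (hb : b ≠ ∞) (hp : p ≠ ∞)
    (h : a + n = b + p + k) : (p : EReal) - n = ((a.toReal - b.toReal : ℝ) : EReal) - k := by
  lift a to NNReal using ha
  lift b to NNReal using hb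
  lift p to NNReal using hp
  cases n with
  | top => simp [show k = ∞ by simpa using h.symm]
  | coe n =>
    cases k with
    | top => simp at h
    | coe k =>
      norm_cast at h
      have hreal : (p : ℝ) - n = a - b - k := by
        have := congrArg NNReal.toReal h
        push_cast at this
        linarith
      exact congrArg Real.toEReal hreal

lemma lintegral_ofReal_sub_lintegral_ofReal_neg {Ω : Type*} [MeasurableSpace Ω] {μ : Measure Ω}
    {f φ : Ω → ℝ} (hf : Integrable f μ) (hφ : AEMeasurable φ μ) (hle : φ ≤ f) :
    ((∫⁻ x, ENNReal.ofReal (φ x) ∂μ : ℝ≥0∞) : EReal) - (∫⁻ x, ENNReal.ofReal (-φ x) ∂μ : ℝ≥0∞)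
      = ((∫ x, f x ∂μ : ℝ) : EReal) - (∫⁻ x, ENNReal.ofReal (f x - φ x) ∂μ : ℝ≥0∞) := by
  have hfm : AEMeasurable f μ := hf.aemeasurable
  have hpos : ∫⁻ x, ENNReal.ofReal (φ x) ∂μ ≠ ∞ :=
    ne_top_of_le_ne_top hf.lintegral_lt_top.ne
      (lintegral_mono fun x ↦ ENNReal.ofReal_le_ofReal (hle x))
  have hparts (x : Ω) : ENNReal.ofReal (f x) + ENNReal.ofReal (-φ x) =
      ENNReal.ofReal (-f x) + ENNReal.ofReal (φ x) + ENNReal.ofReal (f x - φ x) := by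
    have := hle x
    simp only [ENNReal.ofReal]
    norm_cast
    ext
    push_cast [Real.coe_toNNReal']
    grind
  rw [integral_eq_lintegral_pos_part_sub_lintegral_neg_part hf]
  refine coe_ennreal_sub_eq_of_add_eq_add hf.lintegral_lt_top.ne hf.neg.lintegral_lt_top.ne hpos ?_
  rw [← lintegral_add_left' (by fun_prop), ← lintegral_add_left' (by fun_prop),
    ← lintegral_add_left' (by fun_prop)]
  exact lintegral_congr hparts

lemma integrable_of_isFiniteMeasure_withDensity {Ω : Type*} [MeasurableSpace Ω]
    {μ : Measure Ω} {F : Ω → ℝ} (hF : Measurable F) (hF0 : ∀ x, 0 ≤ F x)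
    [IsFiniteMeasure (μ.withDensity fun x ↦ ENNReal.ofReal (F x))] : Integrable F μ := by
  refine ⟨hF.aestronglyMeasurable, ?_⟩
  rw [hasFiniteIntegral_iff_ofReal (ae_of_all _ hF0), ← setLIntegral_univ,
    ← withDensity_apply _ .univ]
  exact measure_lt_top _ _

lemma integral_eq_one_of_isProbabilityMeasure_withDensity {Ω : Type*} [MeasurableSpace Ω]
    {μ : Measure Ω} {F : Ω → ℝ} (hF : Measurable F) (hF0 : ∀ x, 0 ≤ F x)
    [IsProbabilityMeasure (μ.withDensity fun x ↦ ENNReal.ofReal (F x))] : ∫ x, F x ∂μ = 1 := by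
  rw [integral_eq_lintegral_of_nonneg_ae (ae_of_all _ hF0) hF.aestronglyMeasurable,
    ← setLIntegral_univ, ← withDensity_apply _ .univ, measure_univ, ENNReal.toReal_one]

lemma mul_klFun_div {p q : ℝ} (hq : q ≠ 0) :
    q * klFun (p / q) = q - p - p * Real.log q - Real.negMulLog p := by
  rcases eq_or_ne p 0 with rfl | hp
  · simp [klFun_zero]
  · rw [klFun_apply, Real.log_div hp hq, Real.negMulLog]
    field_simp
    ring

lemma lintegral_negMulLog_sub_lintegral_neg_negMulLog {Ω : Type*} [MeasurableSpace Ω]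
    {μ : Measure Ω} [SigmaFinite μ] {F G : Ω → ℝ} (hF : Measurable F) (hG : Measurable G)
    (hF0 : ∀ x, 0 ≤ F x) (hG0 : ∀ x, 0 < G x)
    [IsProbabilityMeasure (μ.withDensity fun x ↦ ENNReal.ofReal (F x))]
    [IsProbabilityMeasure (μ.withDensity fun x ↦ ENNReal.ofReal (G x))]
    (hlog : Integrable (fun x ↦ F x * Real.log (G x)) μ) :
    ((∫⁻ x, ENNReal.ofReal (Real.negMulLog (F x)) ∂μ : ℝ≥0∞) : EReal)
        - (∫⁻ x, ENNReal.ofReal (-Real.negMulLog (F x)) ∂μ : ℝ≥0∞) =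
      ((-∫ x, F x * Real.log (G x) ∂μ : ℝ) : EReal) -
        (klDiv (μ.withDensity fun x ↦ ENNReal.ofReal (F x))
          (μ.withDensity fun x ↦ ENNReal.ofReal (G x)) : ℝ≥0∞) := by
  set f : Ω → ℝ := fun x ↦ G x - F x - F x * Real.log (G x)
  have hFi := integrable_of_isFiniteMeasure_withDensity (μ := μ) hF hF0
  have hGi := integrable_of_isFiniteMeasure_withDensity (μ := μ) hG fun x ↦ (hG0 x).le
  have hf : Integrable f μ := (hGi.sub hFi).sub hlog
  have hgap (x : Ω) : f x - Real.negMulLog (F x) = G x * klFun (F x / G x) :=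
    (mul_klFun_div (hG0 x).ne').symm
  have hle : (fun x ↦ Real.negMulLog (F x)) ≤ f := fun x ↦ sub_nonneg.1 <|
    hgap x ▸ mul_nonneg (hG0 x).le (klFun_nonneg (div_nonneg (hF0 x) (hG0 x).le))
  have hint : ∫ x, f x ∂μ = -∫ x, F x * Real.log (G x) ∂μ := by
    rw [integral_sub (f := fun x ↦ G x - F x) (hGi.sub hFi) hlog, integral_sub hGi hFi,
      integral_eq_one_of_isProbabilityMeasure_withDensity hF hF0,
      integral_eq_one_of_isProbabilityMeasure_withDensity hG fun x ↦ (hG0 x).le, sub_self,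
      zero_sub]
  rw [lintegral_ofReal_sub_lintegral_ofReal_neg hf (by fun_prop) hle, hint,
    klDiv_withDensity_withDensity hF hG hF0 hG0]
  simp only [hgap]

lemma log_gaussianDensity {ι : Type*} [Fintype ι] [DecidableEq ι] (m : EuclideanSpace ℝ ι)
    {S : Matrix ι ι ℝ} (hS : S.PosDef) (x : EuclideanSpace ℝ ι) :
    Real.log (gaussianDensity m S x) =
      -(1 / 2 * Real.log ((2 * Real.pi) ^ Fintype.card ι * S.det)) -
        1 / 2 * (ofLp (x - m) ⬝ᵥ S⁻¹ *ᵥ ofLp (x - m)) := by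
  have := hS.det_pos
  rw [gaussianDensity, Real.log_mul (by positivity) (by positivity),
    Real.log_mul (by positivity) (by positivity), Real.log_exp, Real.log_inv,
    Real.log_sqrt this.le, Real.log_rpow (by positivity),
    Real.log_mul (x := _ ^ _) (by positivity) (by positivity), Real.log_pow]
  ring

section CovMat

variable {d : ℕ} {P : Measure (EuclideanSpace ℝ (Fin d))}

lemma isSymm_covMat : (covMat P).IsSymm := by
  ext i j
  exact covariance_comm _ _

lemma integral_apply (h : Integrable id P) (i : Fin d) : ∫ x, x i ∂P = (∫ x, x ∂P) i :=
  (EuclideanSpace.proj (𝕜 := ℝ) i).integral_comp_comm h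

lemma memLp_apply {p : ℝ≥0∞} (h : MemLp id p P) (i : Fin d) : MemLp (fun x ↦ x i) p P :=
  (EuclideanSpace.proj (𝕜 := ℝ) i).comp_memLp' h

lemma ofLp_sub_dotProduct_mulVec (A : Matrix (Fin d) (Fin d) ℝ)
    (x m : EuclideanSpace ℝ (Fin d)) :
    ofLp (x - m) ⬝ᵥ A *ᵥ ofLp (x - m) = ∑ i, ∑ j, A i j * ((x i - m i) * (x j - m j)) := by
  simp only [dotProduct, mulVec, Finset.mul_sum]
  refine Finset.sum_congr rfl fun i _ ↦ Finset.sum_congr rfl fun j _ ↦ ?_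
  rw [PiLp.sub_apply, PiLp.sub_apply]
  ring

lemma integrable_mul_sub_mul_sub [IsFiniteMeasure P] (h : MemLp id 2 P) (c : ℝ)
    (m : EuclideanSpace ℝ (Fin d)) (i j : Fin d) :
    Integrable (fun x ↦ c * ((x i - m i) * (x j - m j))) P :=
  (((memLp_apply h i).sub (memLp_const _)).integrable_mul
    ((memLp_apply h j).sub (memLp_const _))).const_mul _

lemma integrable_dotProduct_mulVec [IsFiniteMeasure P] (h : MemLp id 2 P)
    (A : Matrix (Fin d) (Fin d) ℝ) (m : EuclideanSpace ℝ (Fin d)) :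
    Integrable (fun x ↦ ofLp (x - m) ⬝ᵥ A *ᵥ ofLp (x - m)) P := by
  simp only [ofLp_sub_dotProduct_mulVec]
  exact integrable_finsetSum _ fun i _ ↦ integrable_finsetSum _ fun j _ ↦
    integrable_mul_sub_mul_sub h _ m i j

lemma integral_dotProduct_mulVec [IsProbabilityMeasure P] (h : MemLp id 2 P)
    (A : Matrix (Fin d) (Fin d) ℝ) :
    ∫ x, ofLp (x - ∫ y, y ∂P) ⬝ᵥ A *ᵥ ofLp (x - ∫ y, y ∂P) ∂P = (A * covMat P).trace := by
  have hint : Integrable id P := h.integrable one_le_two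
  have hij (i j : Fin d) := integrable_mul_sub_mul_sub h (A i j) (∫ y, y ∂P) i j
  simp_rw [ofLp_sub_dotProduct_mulVec]
  rw [integral_finsetSum _ fun i _ ↦ integrable_finsetSum _ fun j _ ↦ hij i j, Matrix.trace]
  refine Finset.sum_congr rfl fun i _ ↦ ?_
  rw [integral_finsetSum _ fun j _ ↦ hij i j, diag_apply, mul_apply]
  refine Finset.sum_congr rfl fun j _ ↦ ?_
  rw [integral_const_mul, ← isSymm_covMat.apply j i, covMat, Matrix.of_apply, covariance,
    integral_apply hint, integral_apply hint]

lemma integrable_log_gaussianDensity [IsFiniteMeasure P] (h : MemLp id 2 P)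
    (m : EuclideanSpace ℝ (Fin d)) {S : Matrix (Fin d) (Fin d) ℝ} (hS : S.PosDef) :
    Integrable (fun x ↦ Real.log (gaussianDensity m S x)) P := by
  simp only [log_gaussianDensity m hS]
  exact (integrable_const _).sub ((integrable_dotProduct_mulVec h _ _).const_mul _)

lemma integral_log_gaussianDensity_covMat [IsProbabilityMeasure P] (h : MemLp id 2 P)
    (hS : (covMat P).PosDef) :
    ∫ x, Real.log (gaussianDensity (∫ y, y ∂P) (covMat P) x) ∂P =
      -(1 / 2 * Real.log ((2 * Real.pi * Real.exp 1) ^ d * (covMat P).det)) := by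
  have := hS.det_pos
  simp only [log_gaussianDensity _ hS]
  rw [integral_sub (integrable_const _) ((integrable_dotProduct_mulVec h _ _).const_mul _),
    integral_const_mul, integral_dotProduct_mulVec h, nonsing_inv_mul _ hS.det_pos.ne'.isUnit,
    trace_one, Fintype.card_fin, integral_const, probReal_univ, one_smul,
    mul_pow _ (Real.exp 1), mul_right_comm, Real.log_mul (y := Real.exp 1 ^ d) (by positivity)
      (by positivity), Real.log_pow (Real.exp 1) d, Real.log_exp]
  ring

lemma diffEntropy_eq_sub_klDiv [IsProbabilityMeasure P] (hac : P ≪ volume) (h : MemLp id 2 P)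
    (hS : (covMat P).PosDef) :
    diffEntropy P
      = ((1 / 2 * Real.log ((2 * Real.pi * Real.exp 1) ^ d * (covMat P).det) : ℝ) : EReal)
        - ((klDiv P (multivariateGaussian (∫ x, x ∂P) (covMat P)) : ℝ≥0∞) : EReal) := by
  set q := gaussianDensity (∫ x, x ∂P) (covMat P)
  set p : EuclideanSpace ℝ (Fin d) → ℝ := fun x ↦ (P.rnDeriv volume x).toReal
  have hPp : (volume.withDensity fun x ↦ ENNReal.ofReal (p x)) = P := by
    conv_rhs => rw [← Measure.withDensity_rnDeriv_eq P volume hac]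
    refine withDensity_congr_ae ?_
    filter_upwards [P.rnDeriv_lt_top volume] with x hx using ENNReal.ofReal_toReal hx.ne
  have hNq := multivariateGaussian_eq_withDensity (∫ x, x ∂P) hS
  have : IsProbabilityMeasure (volume.withDensity fun x ↦ ENNReal.ofReal (p x)) := hPp ▸ ‹_›
  have : IsProbabilityMeasure (volume.withDensity fun x ↦ ENNReal.ofReal (q x)) :=
    hNq ▸ inferInstance
  have hlog : Integrable (fun x ↦ p x * Real.log (q x)) :=
    (integrable_rnDeriv_smul_iff hac).2 (integrable_log_gaussianDensity h _ hS)
  have hkl := lintegral_negMulLog_sub_lintegral_neg_negMulLog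
    (P.measurable_rnDeriv volume).ennreal_toReal (measurable_gaussianDensity _ _)
    (fun _ ↦ ENNReal.toReal_nonneg) (gaussianDensity_pos _ hS) hlog
  have hcross : ∫ x, p x * Real.log (q x) = ∫ x, Real.log (q x) ∂P := integral_rnDeriv_smul hac
  rw [hPp, ← hNq, hcross, integral_log_gaussianDensity_covMat h hS, neg_neg] at hkl
  rw [diffEntropy, if_pos hac, hkl]

lemma diffEntropy_le [IsProbabilityMeasure P] (h : MemLp id 2 P) (hS : (covMat P).PosDef) :
    diffEntropy P
      ≤ ((1 / 2 * Real.log ((2 * Real.pi * Real.exp 1) ^ d * (covMat P).det) : ℝ) : EReal) := by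
  by_cases hac : P ≪ volume
  · rw [diffEntropy_eq_sub_klDiv hac h hS]
    exact EReal.sub_le_of_le_add (le_add_of_nonneg_right (EReal.coe_ennreal_nonneg _))
  · rw [diffEntropy, if_neg hac]
    exact bot_le

end CovMat

end Entropy

section Convolution

open InformationTheory

lemma klDiv_conv_right_le {M : Type*} [AddMonoid M] [MeasurableSpace M] [MeasurableAdd₂ M]
    (μ μ' ν : Measure M) [IsFiniteMeasure μ] [IsFiniteMeasure μ'] [IsProbabilityMeasure ν] :
    klDiv (μ ∗ ν) (μ' ∗ ν) ≤ klDiv μ μ' := by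
  simp only [Measure.conv, ← Measure.compProd_const]
  exact (klDiv_map_le _ _ (by fun_prop)).trans (klDiv_compProd_left μ μ' _).le

lemma withDensity_map_measure {α β : Type*} [MeasurableSpace α] [MeasurableSpace β]
    (μ : Measure α) {T : α → β} (hT : Measurable T) {f : β → ℝ≥0∞} (hf : Measurable f) :
    (μ.map T).withDensity f = (μ.withDensity (f ∘ T)).map T := by
  ext s hs
  rw [withDensity_apply _ hs, setLIntegral_map hs hf hT, Measure.map_apply hT hs,
    withDensity_apply _ (hT hs)]
  rfl

section Moments

variable {E : Type*} [NormedAddCommGroup E] [MeasurableSpace E] [BorelSpace E]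
  [SecondCountableTopology E] {μ ν : Measure E} [IsProbabilityMeasure μ] [IsProbabilityMeasure ν]

lemma memLp_id_conv {p : ℝ≥0∞} (hμ : MemLp id p μ) (hν : MemLp id p ν) : MemLp id p (μ ∗ ν) := by
  rw [Measure.conv, memLp_map_measure_iff (by fun_prop) (by fun_prop)]
  exact (hμ.comp_fst ν).add (hν.comp_snd μ)

lemma integral_id_conv [NormedSpace ℝ E] (hμ : Integrable id μ)
    (hν : Integrable id ν) : ∫ x, x ∂(μ ∗ ν) = ∫ x, x ∂μ + ∫ x, x ∂ν := by
  rw [Measure.conv, integral_map (by fun_prop) (by fun_prop)]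
  refine (integral_add (hμ.comp_fst ν) (hν.comp_snd μ)).trans ?_
  rw [integral_fun_fst, integral_fun_snd]
  simp only [id_eq, probReal_univ, one_smul]

end Moments

lemma covariance_comp_fst_prod {Ω Ω' : Type*} [MeasurableSpace Ω] [MeasurableSpace Ω']
    {μ : Measure Ω} {ν : Measure Ω'} [IsProbabilityMeasure ν] {X Y : Ω → ℝ}
    (hX : AEStronglyMeasurable X μ) (hY : AEStronglyMeasurable Y μ) :
    cov[fun x ↦ X x.1, fun x ↦ Y x.1; μ.prod ν] = cov[X, Y; μ] := by
  have hfst : (μ.prod ν).map Prod.fst = μ := Measure.fst_prod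
  conv_rhs => rw [← hfst, covariance_map (by rwa [hfst]) (by rwa [hfst]) (by fun_prop)]
  rfl

lemma covariance_comp_snd_prod {Ω Ω' : Type*} [MeasurableSpace Ω] [MeasurableSpace Ω']
    {μ : Measure Ω} {ν : Measure Ω'} [IsProbabilityMeasure μ] [SFinite ν] {X Y : Ω' → ℝ}
    (hX : AEStronglyMeasurable X ν) (hY : AEStronglyMeasurable Y ν) :
    cov[fun x ↦ X x.2, fun x ↦ Y x.2; μ.prod ν] = cov[X, Y; ν] := by
  have hsnd : (μ.prod ν).map Prod.snd = ν := Measure.snd_prod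
  conv_rhs => rw [← hsnd, covariance_map (by rwa [hsnd]) (by rwa [hsnd]) (by fun_prop)]
  rfl

end Convolution

section CovarianceMatrix

open Matrix WithLp
open scoped MatrixOrder

variable {d : ℕ} {P Q : Measure (EuclideanSpace ℝ (Fin d))}

lemma covMat_multivariateGaussian (m : EuclideanSpace ℝ (Fin d)) {S : Matrix (Fin d) (Fin d) ℝ}
    (hS : S.PosSemidef) : covMat (multivariateGaussian m S) = S := by
  ext i j
  exact covariance_eval_multivariateGaussian hS i j

lemma covMat_conv [IsProbabilityMeasure P] [IsProbabilityMeasure Q] (hP : MemLp id 2 P)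
    (hQ : MemLp id 2 Q) : covMat (P ∗ Q) = covMat P + covMat Q := by
  ext i j
  have hfst (i : Fin d) : MemLp (fun x ↦ x.1 i) 2 (P.prod Q) := (memLp_apply hP i).comp_fst Q
  have hsnd (i : Fin d) : MemLp (fun x ↦ x.2 i) 2 (P.prod Q) := (memLp_apply hQ i).comp_snd P
  have hcross (i j : Fin d) : cov[fun x ↦ x.1 i, fun x ↦ x.2 j; P.prod Q] = 0 :=
    covariance_fst_snd_prod (memLp_apply hP i) (memLp_apply hQ j)
  have hcross' : cov[fun x ↦ x.2 i, fun x ↦ x.1 j; P.prod Q] = 0 :=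
    (covariance_comm _ _).trans (hcross j i)
  calc cov[fun x ↦ x i, fun x ↦ x j; P ∗ Q]
      = cov[(fun x ↦ x.1 i) + fun x ↦ x.2 i, (fun x ↦ x.1 j) + fun x ↦ x.2 j; P.prod Q] :=
        covariance_map_fun (by fun_prop) (by fun_prop) (by fun_prop)
    _ = cov[fun x ↦ x.1 i, fun x ↦ x.1 j; P.prod Q]
          + cov[fun x ↦ x.2 i, fun x ↦ x.2 j; P.prod Q] := by
        rw [covariance_add_left (hfst i) (hsnd i) ((hfst j).add (hsnd j)),
          covariance_add_right (hfst i) (hfst j) (hsnd j),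
          covariance_add_right (hsnd i) (hfst j) (hsnd j), hcross, hcross', add_zero,
          zero_add]
    _ = cov[fun x ↦ x i, fun x ↦ x j; P] + cov[fun x ↦ x i, fun x ↦ x j; Q] := by
        rw [covariance_comp_fst_prod (memLp_apply hP i).1 (memLp_apply hP j).1,
          covariance_comp_snd_prod (memLp_apply hQ i).1 (memLp_apply hQ j).1]

lemma covMat_map_toEuclideanCLM [IsFiniteMeasure P] (h : MemLp id 2 P)
    (M : Matrix (Fin d) (Fin d) ℝ) :
    covMat (P.map (toEuclideanCLM (𝕜 := ℝ) M)) = M * covMat P * Mᵀ := by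
  ext i j
  have hM (i k : Fin d) : MemLp (fun x : EuclideanSpace ℝ (Fin d) ↦ M i k * x k) 2 P :=
    (memLp_apply h k).const_mul _
  rw [covMat, of_apply, covariance_map_fun (by fun_prop) (by fun_prop) (by fun_prop)]
  simp only [ofLp_toEuclideanCLM, mulVec, dotProduct]
  rw [covariance_fun_sum_fun_sum (hM i) (hM j), Finset.sum_comm, mul_apply]
  simp only [covariance_const_mul_left, covariance_const_mul_right, mul_apply, Finset.sum_mul,
    transpose_apply, covMat, of_apply]
  refine Finset.sum_congr rfl fun k _ ↦ Finset.sum_congr rfl fun l _ ↦ ?_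
  ring

lemma dotProduct_covMat_mulVec [IsFiniteMeasure P] (h : MemLp id 2 P) (v : Fin d → ℝ) :
    v ⬝ᵥ covMat P *ᵥ v = Var[fun x ↦ v ⬝ᵥ ofLp x; P] := by
  have hv (i : Fin d) : MemLp (fun x : EuclideanSpace ℝ (Fin d) ↦ v i * x i) 2 P :=
    (memLp_apply h i).const_mul _
  rw [← covariance_self (by simp only [dotProduct]; fun_prop)]
  simp only [dotProduct, mulVec, covMat, of_apply]
  rw [covariance_fun_sum_fun_sum hv hv]
  simp only [covariance_const_mul_left, covariance_const_mul_right, Finset.mul_sum]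
  refine Finset.sum_congr rfl fun i _ ↦ Finset.sum_congr rfl fun j _ ↦ ?_
  ring

lemma posSemidef_covMat [IsFiniteMeasure P] (h : MemLp id 2 P) : (covMat P).PosSemidef := by
  refine .of_dotProduct_mulVec_nonneg ?_ fun v ↦ ?_
  · rw [IsHermitian, conjTranspose_eq_transpose_of_trivial, isSymm_covMat]
  · rw [star_trivial, dotProduct_covMat_mulVec h]
    exact variance_nonneg _ _

lemma covMat_le_smul_covMat [IsProbabilityMeasure P] [IsFiniteMeasure Q] {C : ℝ} (hC : 0 ≤ C)
    (hPQ : P ≤ ENNReal.ofReal C • Q) (hQ : MemLp id 2 Q) : covMat P ≤ C • covMat Q := by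
  have hP : MemLp id 2 P := hQ.of_measure_le_smul ENNReal.ofReal_ne_top hPQ
  refine le_iff.2 (.of_dotProduct_mulVec_nonneg ?_ fun v ↦ ?_)
  · exact ((posSemidef_covMat hQ).smul hC).1.sub (posSemidef_covMat hP).1
  set m := ∫ x, v ⬝ᵥ ofLp x ∂Q
  have hv : MemLp (fun x : EuclideanSpace ℝ (Fin d) ↦ v ⬝ᵥ ofLp x) 2 Q :=
    memLp_finsetSum _ fun i _ ↦ (memLp_apply hQ i).const_mul _
  have hint : Integrable (fun x : EuclideanSpace ℝ (Fin d) ↦ (v ⬝ᵥ ofLp x - m) ^ 2)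
      (ENNReal.ofReal C • Q) :=
    (hv.sub (memLp_const m)).integrable_sq.smul_measure ENNReal.ofReal_ne_top
  have hvar : Var[fun x ↦ v ⬝ᵥ ofLp x; P] ≤ C * Var[fun x ↦ v ⬝ᵥ ofLp x; Q] := by
    have hmeas : AEStronglyMeasurable (fun x ↦ v ⬝ᵥ ofLp x) P := by
      simp only [dotProduct]
      fun_prop
    calc Var[fun x ↦ v ⬝ᵥ ofLp x; P] = Var[fun x ↦ v ⬝ᵥ ofLp x - m; P] :=
          (variance_sub_const hmeas m).symm
      _ ≤ ∫ x, (v ⬝ᵥ ofLp x - m) ^ 2 ∂P :=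
          variance_le_expectation_sq (hmeas.sub aestronglyMeasurable_const)
      _ ≤ ∫ x, (v ⬝ᵥ ofLp x - m) ^ 2 ∂(ENNReal.ofReal C • Q) :=
          integral_mono_measure hPQ (ae_of_all _ fun x ↦ sq_nonneg _) hint
      _ = C * Var[fun x ↦ v ⬝ᵥ ofLp x; Q] := by
          rw [integral_smul_measure, ENNReal.toReal_ofReal hC, smul_eq_mul,
            variance_eq_integral hv.1.aemeasurable]
  rw [star_trivial, sub_mulVec, smul_mulVec, dotProduct_sub, dotProduct_smul, smul_eq_mul,
    dotProduct_covMat_mulVec hP, dotProduct_covMat_mulVec hQ]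
  exact sub_nonneg.2 hvar

lemma absolutelyContinuous_of_linftyDist_le {ε : ℝ} (h : linftyDist P Q ≤ ENNReal.ofReal ε) :
    P ≪ Q := by
  by_contra hac
  simp [linftyDist, hac] at h

lemma exists_density_of_linftyDist_le [SigmaFinite P] [SigmaFinite Q] {ε : ℝ} (hε : 0 ≤ ε)
    (h : linftyDist P Q ≤ ENNReal.ofReal ε) :
    ∃ f : EuclideanSpace ℝ (Fin d) → ℝ, Measurable f ∧ (∀ x, 1 - ε ≤ f x ∧ f x ≤ 1 + ε) ∧
      P = Q.withDensity (fun x ↦ ENNReal.ofReal (f x)) := by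
  have hac := absolutelyContinuous_of_linftyDist_le h
  rw [linftyDist, if_pos hac, eLpNorm_exponent_top] at h
  refine ⟨fun x ↦ max (1 - ε) (min (1 + ε) (P.rnDeriv Q x).toReal), by fun_prop,
    fun x ↦ ⟨le_max_left _ _, max_le (by linarith) (min_le_left _ _)⟩, ?_⟩
  refine (Measure.withDensity_rnDeriv_eq P Q hac).symm.trans (withDensity_congr_ae ?_)
  filter_upwards [enorm_ae_le_eLpNormEssSup (fun x ↦ (P.rnDeriv Q x).toReal - 1) Q,
    P.rnDeriv_lt_top Q] with x hdist hfin
  have hclose := hdist.trans h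
  rw [Real.enorm_eq_ofReal_abs, ENNReal.ofReal_le_ofReal_iff hε, abs_le] at hclose
  rw [min_eq_right (by linarith), max_eq_right (by linarith), ENNReal.ofReal_toReal hfin.ne]

end CovarianceMatrix

section Contraction

open Matrix WithLp InformationTheory Filter
open scoped MatrixOrder Topology

lemma exists_ouScale {u k : ℝ} (hu : 0 < u) (hk : 0 < k)
    (h : k < u / ((1 + u) ^ (1 / 3 : ℝ) - 1)) :
    ∃ ρ : ℝ, 0 < ρ ∧ ρ < 1 ∧ (1 - ρ ^ 2) / ρ ^ 2 * k < u ∧ (1 + u) * ρ ^ 6 < 1 := by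
  set w := (1 + u) ^ (1 / 3 : ℝ) - 1 with hw
  have hw3 : (1 + w) ^ 3 = 1 + u := by
    rw [hw, add_sub_cancel, ← Real.rpow_natCast, ← Real.rpow_mul (by positivity)]
    norm_num
  have hw0 : 0 < w := sub_pos.2 (Real.one_lt_rpow (by linarith) (by norm_num))
  obtain ⟨s, hws, hsu⟩ := exists_between ((lt_div_comm₀ hk hw0).1 h)
  have hs : 0 < s := hw0.trans hws
  have hρ2 : (√(1 + s))⁻¹ ^ 2 = (1 + s)⁻¹ := by rw [inv_pow, Real.sq_sqrt (by positivity)]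
  refine ⟨(√(1 + s))⁻¹, by positivity, ?_, ?_, ?_⟩
  · rw [inv_lt_one₀ (by positivity), Real.lt_sqrt zero_le_one]
    linarith
  · rw [lt_div_iff₀ hk] at hsu
    convert! hsu using 2
    rw [hρ2]
    field_simp
    ring
  · rw [show 6 = 2 * 3 from rfl, pow_mul, hρ2, inv_pow, ← hw3, ← div_eq_mul_inv,
      div_lt_one (by positivity)]
    gcongr

lemma posSemidef_mul_transpose_self {ι : Type*} [Fintype ι] (A : Matrix ι ι ℝ) :
    (A * Aᵀ).PosSemidef := by
  simpa using posSemidef_self_mul_conjTranspose A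

section Rescaling

variable {ι : Type*} [Fintype ι] [DecidableEq ι]

lemma map_stdGaussian_toEuclideanCLM (M : Matrix ι ι ℝ) :
    (stdGaussian (EuclideanSpace ℝ ι)).map (toEuclideanCLM (𝕜 := ℝ) M)
      = multivariateGaussian 0 (M * Mᵀ) := by
  rw [← multivariateGaussian_zero_one, map_toEuclideanCLM_multivariateGaussian_zero PosSemidef.one,
    Matrix.mul_one]

lemma toEuclideanCLM_comp_smul (c : ℝ) (M : Matrix ι ι ℝ) :
    toEuclideanCLM (𝕜 := ℝ) M ∘ (fun x ↦ c • x) = toEuclideanCLM (𝕜 := ℝ) (c • M) := by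
  ext1 x
  rw [Function.comp_apply, map_smul, map_smul]
  rfl

lemma toEuclideanCLM_comp_of_mul_eq_one {A M : Matrix ι ι ℝ} (hMA : M * A = 1) :
    toEuclideanCLM (𝕜 := ℝ) M ∘ toEuclideanCLM (𝕜 := ℝ) A = id := by
  ext1 x
  have hmul := congrArg (fun T ↦ T x) (map_mul (toEuclideanCLM (n := ι) (𝕜 := ℝ)) M A)
  simp only [hMA, map_one] at hmul
  exact hmul.symm

lemma map_ouMeasure_conv_multivariateGaussian {ρ : ℝ} (h0 : 0 < ρ) (h1 : ρ ≤ 1)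
    (μ : Measure (EuclideanSpace ℝ ι)) [SFinite μ] (A : Matrix ι ι ℝ) {T : Matrix ι ι ℝ}
    (hT : T.PosSemidef) :
    (ouMeasure ρ μ).map (toEuclideanCLM (𝕜 := ℝ) (ρ⁻¹ • A)) ∗ multivariateGaussian 0 T
      = μ.map (toEuclideanCLM (𝕜 := ℝ) A) ∗
        multivariateGaussian 0 (((1 - ρ ^ 2) / ρ ^ 2) • (A * Aᵀ) + T) := by
  have hρ := one_sub_sq_nonneg h0.le h1
  have hcoef : √(1 - ρ ^ 2) * ρ⁻¹ * (√(1 - ρ ^ 2) * ρ⁻¹) = (1 - ρ ^ 2) / ρ ^ 2 := by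
    rw [mul_mul_mul_comm, Real.mul_self_sqrt hρ, ← mul_inv, ← pow_two, div_eq_mul_inv]
  have hcov : ((√(1 - ρ ^ 2) * ρ⁻¹) • A) * ((√(1 - ρ ^ 2) * ρ⁻¹) • A)ᵀ
      = ((1 - ρ ^ 2) / ρ ^ 2) • (A * Aᵀ) := by
    rw [transpose_smul, Matrix.smul_mul, Matrix.mul_smul, smul_smul, hcoef]
  rw [ouMeasure, Measure.map_conv_continuousLinearMap, Measure.map_map (by fun_prop) (by fun_prop),
    Measure.map_map (by fun_prop) (by fun_prop), toEuclideanCLM_comp_smul,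
    toEuclideanCLM_comp_smul, smul_smul, smul_smul, mul_inv_cancel₀ h0.ne', one_smul,
    map_stdGaussian_toEuclideanCLM, hcov, Measure.conv_assoc,
    multivariateGaussian_conv_multivariateGaussian
      ((posSemidef_mul_transpose_self A).smul (by positivity)) hT, zero_add]

lemma mul_klDiv_conv_multivariateGaussian_le {ρ : ℝ} (h0 : 0 < ρ) (h1 : ρ ≤ 1)
    {A M S : Matrix ι ι ℝ} (hAM : A * M = 1) (hS : ((1 - ρ ^ 2) / ρ ^ 2) • (A * Aᵀ) ≤ S)
    {μ ν : Measure (EuclideanSpace ℝ ι)} [IsProbabilityMeasure μ] [IsProbabilityMeasure ν]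
    {κ : ℝ≥0∞}
    (h : κ * klDiv (ouMeasure ρ (μ.map (toEuclideanCLM (𝕜 := ℝ) M)))
        (ouMeasure ρ (ν.map (toEuclideanCLM (𝕜 := ℝ) M)))
      ≤ klDiv (μ.map (toEuclideanCLM (𝕜 := ℝ) M)) (ν.map (toEuclideanCLM (𝕜 := ℝ) M))) :
    κ * klDiv (μ ∗ multivariateGaussian 0 S) (ν ∗ multivariateGaussian 0 S) ≤ klDiv μ ν := by
  have hheat (m : Measure (EuclideanSpace ℝ ι)) [IsProbabilityMeasure m] :
      m ∗ multivariateGaussian 0 S =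
        (ouMeasure ρ (m.map (toEuclideanCLM (𝕜 := ℝ) M))).map (toEuclideanCLM (𝕜 := ℝ) (ρ⁻¹ • A))
          ∗ multivariateGaussian 0 (S - ((1 - ρ ^ 2) / ρ ^ 2) • (A * Aᵀ)) := by
    rw [map_ouMeasure_conv_multivariateGaussian h0 h1 _ A (le_iff.1 hS), add_sub_cancel,
      Measure.map_map (by fun_prop) (by fun_prop), toEuclideanCLM_comp_of_mul_eq_one hAM,
      Measure.map_id]
  have hprob (m : Measure (EuclideanSpace ℝ ι)) [IsProbabilityMeasure m] :
      IsProbabilityMeasure (ouMeasure ρ (m.map (toEuclideanCLM (𝕜 := ℝ) M))) := by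
    have := Measure.isProbabilityMeasure_map (μ := m) (f := toEuclideanCLM (𝕜 := ℝ) M)
      (by fun_prop)
    have := Measure.isProbabilityMeasure_map (μ := m.map (toEuclideanCLM (𝕜 := ℝ) M))
      (f := fun x ↦ ρ • x) (by fun_prop)
    have := Measure.isProbabilityMeasure_map (μ := stdGaussian (EuclideanSpace ℝ ι))
      (f := fun x ↦ √(1 - ρ ^ 2) • x) (by fun_prop)
    unfold ouMeasure
    infer_instance
  have := hprob μ
  have := hprob ν
  calc κ * klDiv (μ ∗ multivariateGaussian 0 S) (ν ∗ multivariateGaussian 0 S)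
      ≤ κ * klDiv (ouMeasure ρ (μ.map (toEuclideanCLM (𝕜 := ℝ) M)))
        (ouMeasure ρ (ν.map (toEuclideanCLM (𝕜 := ℝ) M))) := by
        rw [hheat μ, hheat ν]
        gcongr
        exact (klDiv_conv_right_le _ _ _).trans (klDiv_map_le _ _ (by fun_prop))
    _ ≤ klDiv (μ.map (toEuclideanCLM (𝕜 := ℝ) M)) (ν.map (toEuclideanCLM (𝕜 := ℝ) M)) := h
    _ ≤ klDiv μ ν := klDiv_map_le _ _ (by fun_prop)

lemma map_toEuclideanCLM_withDensity {A M : Matrix ι ι ℝ} (hAM : A * M = 1)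
    (μ : Measure (EuclideanSpace ℝ ι)) {f : EuclideanSpace ℝ ι → ℝ≥0∞} (hf : Measurable f) :
    (μ.withDensity f).map (toEuclideanCLM (𝕜 := ℝ) M)
      = (μ.map (toEuclideanCLM (𝕜 := ℝ) M)).withDensity (f ∘ toEuclideanCLM (𝕜 := ℝ) A) := by
  rw [withDensity_map_measure _ (by fun_prop) (by fun_prop), Function.comp_assoc,
    toEuclideanCLM_comp_of_mul_eq_one hAM, Function.comp_id]

lemma exists_mul_eq_one_and_mul_transpose_eq {K : Matrix ι ι ℝ} (hK : K.PosDef) :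
    ∃ A M : Matrix ι ι ℝ, M * A = 1 ∧ A * Aᵀ = K :=
  ⟨CFC.sqrt K, (CFC.sqrt K)⁻¹, nonsing_inv_mul _ (det_cfcSqrt_pos hK).ne'.isUnit, by
    rw [transpose_eq_of_nonneg (CFC.sqrt_nonneg K),
      CFC.sqrt_mul_sqrt_self K hK.posSemidef.nonneg]⟩

end Rescaling

lemma integral_withDensity_ofReal {Ω : Type*} [MeasurableSpace Ω] {μ : Measure Ω} {F : Ω → ℝ}
    (hF : Measurable F) (h0 : ∀ x, 0 ≤ F x) (g : Ω → ℝ) :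
    ∫ x, g x ∂(μ.withDensity fun x ↦ ENNReal.ofReal (F x)) = ∫ x, F x * g x ∂μ := by
  rw [integral_withDensity_eq_integral_toReal_smul (by fun_prop) (by simp)]
  simp only [ENNReal.toReal_ofReal (h0 _), smul_eq_mul]

lemma orthQuadratic_sub_of_moments {E : Type*} [NormedAddCommGroup E] [InnerProductSpace ℝ E]
    [FiniteDimensional ℝ E] [MeasurableSpace E] [BorelSpace E] {F G : E → ℝ} {C : ℝ}
    (hF : Measurable F) (hG : Measurable G) (hF' : ∀ x, 0 ≤ F x ∧ F x ≤ C)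
    (hG' : ∀ x, 0 ≤ G x ∧ G x ≤ C)
    {μ ν : Measure E} [IsProbabilityMeasure μ] [IsProbabilityMeasure ν]
    (hμ : μ = (stdGaussian E).withDensity fun x ↦ ENNReal.ofReal (F x))
    (hν : ν = (stdGaussian E).withDensity fun x ↦ ENNReal.ofReal (G x))
    (h1 : ∀ v, ∫ x, inner ℝ v x ∂μ = ∫ x, inner ℝ v x ∂ν)
    (h2 : ∀ v, ∫ x, inner ℝ v x ^ 2 ∂μ = ∫ x, inner ℝ v x ^ 2 ∂ν) :
    OrthQuadratic (fun x ↦ F x - G x) := by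
  have hmul {H : E → ℝ} (hH : Measurable H) (hH' : ∀ x, 0 ≤ H x ∧ H x ≤ C) {g : E → ℝ}
      (hg : Integrable g (stdGaussian E)) : Integrable (fun x ↦ H x * g x) (stdGaussian E) :=
    hg.bdd_mul (c := C) hH.aestronglyMeasurable
      (ae_of_all _ fun x ↦ (Real.norm_of_nonneg (hH' x).1).trans_le (hH' x).2)
  have horth (g : E → ℝ) (hg : Integrable g (stdGaussian E))
      (h : ∫ x, g x ∂μ = ∫ x, g x ∂ν) : ∫ x, (F x - G x) * g x ∂(stdGaussian E) = 0 := by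
    simp_rw [sub_mul]
    rw [integral_sub (hmul hF hF' hg) (hmul hG hG' hg),
      ← integral_withDensity_ofReal hF (fun x ↦ (hF' x).1),
      ← integral_withDensity_ofReal hG (fun x ↦ (hG' x).1), ← hμ, ← hν, h, sub_self]
  refine ⟨?_, fun v ↦ horth _ (integrable_inner_stdGaussian v) (h1 v),
    fun v ↦ horth _ (integrable_inner_sq_stdGaussian v) (h2 v)⟩
  simpa using horth (fun _ ↦ 1) (integrable_const _) (by simp)

lemma eventually_perturbation_bounds (n : ℕ) {η : ℝ} (hη : 0 < η) :
    ∀ᶠ ε : ℝ in 𝓝 0, (1 + η)⁻¹ < 1 - ε ∧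
      (1 + ε) * (√(((1 - ε) / (1 + ε)) ^ n))⁻¹ < 1 + η ∧
      (((1 - ε) / (1 + ε))⁻¹ - 1) / 2 < η := by
  have hratio : ContinuousAt (fun ε : ℝ ↦ (1 - ε) / (1 + ε)) 0 :=
    .div (by fun_prop) (by fun_prop) (by norm_num)
  have hsub : ContinuousAt (fun ε : ℝ ↦ 1 - ε) 0 := by fun_prop
  have hsqrt : ContinuousAt (fun ε : ℝ ↦ (1 + ε) * (√(((1 - ε) / (1 + ε)) ^ n))⁻¹) 0 :=
    .mul (by fun_prop) (.inv₀ (Real.continuous_sqrt.continuousAt.comp (hratio.pow n)) (by simp))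
  have hinv : ContinuousAt (fun ε : ℝ ↦ (((1 - ε) / (1 + ε))⁻¹ - 1) / 2) 0 :=
    ((hratio.inv₀ (by norm_num)).sub continuousAt_const).div_const 2
  have hη1 : (1 + η)⁻¹ < 1 := inv_lt_one_of_one_lt₀ (by linarith)
  exact (hsub.eventually_const_lt (by simpa using hη1)).and
    ((hsqrt.eventually_lt_const (by simpa using hη)).and
      (hinv.eventually_lt_const (by simpa using hη)))

lemma eventually_exists_isPinched {ι : Type*} [Fintype ι] [DecidableEq ι] {η : ℝ} (hη : 0 < η) :
    ∀ᶠ ε : ℝ in 𝓝[>] 0, ∀ S : Matrix ι ι ℝ, ((1 - ε) / (1 + ε)) • 1 ≤ S → S ≤ 1 →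
      ∃ g : EuclideanSpace ℝ ι → ℝ, Measurable g ∧
        multivariateGaussian 0 S = (stdGaussian _).withDensity (fun x ↦ ENNReal.ofReal (g x)) ∧
        ∀ f : EuclideanSpace ℝ ι → ℝ, Measurable f → (∀ x, 1 - ε ≤ f x ∧ f x ≤ 1 + ε) →
          IsPinched η (fun x ↦ f x * g x) := by
  filter_upwards [(eventually_perturbation_bounds (Fintype.card ι) hη).filter_mono
    nhdsWithin_le_nhds, self_mem_nhdsWithin] with ε ⟨hlow, hup, hexp⟩ hε S hcS hS1
  rw [Set.mem_Ioi] at hε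
  have hε1 : 0 < 1 - ε := lt_trans (by positivity) hlow
  obtain ⟨g, hg, hSg, hgb⟩ := exists_density_multivariateGaussian (by positivity) hcS hS1
  have hg0 (x : EuclideanSpace ℝ ι) : 0 ≤ g x := (Real.exp_pos _).le.trans (hgb x).1
  refine ⟨g, hg, hSg, fun f hf hfb ↦ ⟨hf.mul hg, fun x ↦ ?_, fun x ↦ ?_⟩⟩
  · have := hg0 x
    grw [← hfb x |>.1, ← hlow, ← hgb x |>.1, hexp]
  · have := hg0 x
    grw [(hfb x).2, (hgb x).2, hup]

section Whitening

variable {d : ℕ} {P Q : Measure (EuclideanSpace ℝ (Fin d))}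

lemma integral_inner_sq [IsProbabilityMeasure P] (h : MemLp id 2 P)
    (v : EuclideanSpace ℝ (Fin d)) :
    ∫ x, inner ℝ v x ^ 2 ∂P
      = ofLp v ⬝ᵥ covMat P *ᵥ ofLp v + inner ℝ v (∫ x, x ∂P) ^ 2 := by
  have hinner (x : EuclideanSpace ℝ (Fin d)) : inner ℝ v x = ofLp v ⬝ᵥ ofLp x := by
    rw [EuclideanSpace.inner_eq_star_dotProduct, star_trivial, dotProduct_comm]
  have hv : MemLp (fun x : EuclideanSpace ℝ (Fin d) ↦ inner ℝ v x) 2 P := h.const_inner v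
  have hmean : ∫ x, inner ℝ v x ∂P = inner ℝ v (∫ x, x ∂P) :=
    integral_inner (h.integrable one_le_two) v
  rw [dotProduct_covMat_mulVec h, ← hmean]
  simp only [← hinner]
  rw [variance_eq_sub hv, sub_add_cancel]
  rfl

lemma smul_le_and_le_smul_of_linftyDist_le [SigmaFinite P] [SigmaFinite Q] {ε : ℝ} (hε : 0 ≤ ε)
    (h : linftyDist P Q ≤ ENNReal.ofReal ε) :
    ENNReal.ofReal (1 - ε) • Q ≤ P ∧ P ≤ ENNReal.ofReal (1 + ε) • Q := by
  obtain ⟨f, -, hfb, hP⟩ := exists_density_of_linftyDist_le hε h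
  rw [hP, ← withDensity_const, ← withDensity_const]
  exact ⟨withDensity_mono (ae_of_all _ fun x ↦ ENNReal.ofReal_le_ofReal (hfb x).1),
    withDensity_mono (ae_of_all _ fun x ↦ ENNReal.ofReal_le_ofReal (hfb x).2)⟩

lemma memLp_of_linftyDist_le [SigmaFinite P] [SigmaFinite Q] {ε : ℝ} (hε : 0 ≤ ε)
    (h : linftyDist P Q ≤ ENNReal.ofReal ε) {p : ℝ≥0∞} (hQ : MemLp id p Q) : MemLp id p P :=
  hQ.of_measure_le_smul ENNReal.ofReal_ne_top (smul_le_and_le_smul_of_linftyDist_le hε h).2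

lemma covMat_le_of_linftyDist_le [IsProbabilityMeasure P] [IsFiniteMeasure Q] {ε : ℝ}
    (hε : 0 ≤ ε) (h : linftyDist P Q ≤ ENNReal.ofReal ε) (hQ : MemLp id 2 Q) :
    covMat P ≤ (1 + ε) • covMat Q :=
  covMat_le_smul_covMat (by positivity) (smul_le_and_le_smul_of_linftyDist_le hε h).2 hQ

lemma le_covMat_of_linftyDist_le [IsProbabilityMeasure P] [IsProbabilityMeasure Q] {ε : ℝ}
    (hε : 0 ≤ ε) (hε1 : ε < 1) (h : linftyDist P Q ≤ ENNReal.ofReal ε) (hQ : MemLp id 2 Q) :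
    (1 - ε) • covMat Q ≤ covMat P := by
  have hε' : 0 < 1 - ε := sub_pos.2 hε1
  have hQP : Q ≤ ENNReal.ofReal (1 - ε)⁻¹ • P := by
    grw [← (smul_le_and_le_smul_of_linftyDist_le hε h).1]
    rw [smul_smul, ← ENNReal.ofReal_mul (by positivity), inv_mul_cancel₀ hε'.ne',
      ENNReal.ofReal_one, one_smul]
  calc (1 - ε) • covMat Q ≤ (1 - ε) • (1 - ε)⁻¹ • covMat P := by
        gcongr
        exact covMat_le_smul_covMat (by positivity) hQP (memLp_of_linftyDist_le hε h hQ)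
    _ = covMat P := smul_inv_smul₀ hε'.ne' _

lemma posDef_covMat_of_linftyDist_le [IsProbabilityMeasure P] {K : Matrix (Fin d) (Fin d) ℝ}
    (hK : K.PosDef) {ε : ℝ} (hε : 0 ≤ ε) (hε1 : ε < 1)
    (h : linftyDist P (multivariateGaussian 0 K) ≤ ENNReal.ofReal ε) : (covMat P).PosDef := by
  have hle := le_covMat_of_linftyDist_le hε hε1 h IsGaussian.memLp_two_id
  rw [covMat_multivariateGaussian 0 hK.posSemidef] at hle
  simpa using (hK.smul (sub_pos.2 hε1)).add_posSemidef (le_iff.1 hle)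

end Whitening

end Contraction

section Stability

open Matrix WithLp InformationTheory Filter
open scoped MatrixOrder Topology

lemma orthQuadratic_sub_of_covMat_eq {d : ℕ} {F G : EuclideanSpace ℝ (Fin d) → ℝ} {C : ℝ}
    (hF : Measurable F) (hG : Measurable G) (hF' : ∀ x, 0 ≤ F x ∧ F x ≤ C)
    (hG' : ∀ x, 0 ≤ G x ∧ G x ≤ C) {μ ν : Measure (EuclideanSpace ℝ (Fin d))}
    [IsProbabilityMeasure μ] [IsProbabilityMeasure ν]
    (hμF : μ = (stdGaussian _).withDensity fun x ↦ ENNReal.ofReal (F x))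
    (hνG : ν = (stdGaussian _).withDensity fun x ↦ ENNReal.ofReal (G x))
    (hμ : MemLp id 2 μ) (hν : MemLp id 2 ν) (hmean : ∫ x, x ∂μ = ∫ x, x ∂ν)
    (hcov : covMat μ = covMat ν) : OrthQuadratic (fun x ↦ F x - G x) := by
  refine orthQuadratic_sub_of_moments hF hG hF' hG' hμF hνG (fun v ↦ ?_) fun v ↦ ?_
  · have hinner {m : Measure (EuclideanSpace ℝ (Fin d))} [IsProbabilityMeasure m]
        (hm : MemLp id 2 m) : ∫ x, inner ℝ v x ∂m = inner ℝ v (∫ x, x ∂m) :=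
      integral_inner (hm.integrable one_le_two) v
    rw [hinner hμ, hinner hν, hmean]
  · rw [integral_inner_sq hμ, integral_inner_sq hν, hmean, hcov]

lemma mul_mul_transpose_le {ι : Type*} [Fintype ι] {S T : Matrix ι ι ℝ} (h : S ≤ T)
    (M : Matrix ι ι ℝ) : M * S * Mᵀ ≤ M * T * Mᵀ := by
  simpa [star_eq_conjTranspose, conjTranspose_eq_transpose_of_trivial]
    using star_right_conjugate_le_conjugate h M

lemma mul_mul_transpose_eq_smul_one {ι : Type*} [Fintype ι] [DecidableEq ι] {A M K : Matrix ι ι ℝ}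
    {c : ℝ} (hc : c ≠ 0) (hMA : M * A = 1) (hA : A * Aᵀ = c • K) :
    M * K * Mᵀ = c⁻¹ • (1 : Matrix ι ι ℝ) := by
  rw [eq_inv_smul_iff₀ hc, ← Matrix.smul_mul, ← Matrix.mul_smul, ← hA, ← Matrix.mul_assoc, hMA,
    Matrix.one_mul, ← transpose_mul, hMA, transpose_one]

variable {d : ℕ}

lemma memLp_map_toEuclideanCLM {μ : Measure (EuclideanSpace ℝ (Fin d))} {p : ℝ≥0∞}
    (h : MemLp id p μ) (M : Matrix (Fin d) (Fin d) ℝ) :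
    MemLp id p (μ.map (toEuclideanCLM (𝕜 := ℝ) M)) :=
  (memLp_map_measure_iff (by fun_prop) (by fun_prop)).2 ((toEuclideanCLM (𝕜 := ℝ) M).comp_memLp' h)

lemma integral_map_toEuclideanCLM {μ : Measure (EuclideanSpace ℝ (Fin d))}
    (h : Integrable (fun x ↦ x) μ) (M : Matrix (Fin d) (Fin d) ℝ) :
    ∫ x, x ∂(μ.map (toEuclideanCLM (𝕜 := ℝ) M)) = toEuclideanCLM (𝕜 := ℝ) M (∫ x, x ∂μ) := by
  rw [integral_map (by fun_prop) (by fun_prop), ContinuousLinearMap.integral_comp_comm _ h]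

lemma map_toEuclideanCLM_withDensity_multivariateGaussian {A M K : Matrix (Fin d) (Fin d) ℝ}
    (hAM : A * M = 1) (hK : K.PosSemidef) {f g : EuclideanSpace ℝ (Fin d) → ℝ} (hf : Measurable f)
    (hf0 : ∀ x, 0 ≤ f x) (hg : Measurable g)
    (hKg : multivariateGaussian 0 (M * K * Mᵀ)
      = (stdGaussian _).withDensity fun x ↦ ENNReal.ofReal (g x)) :
    ((multivariateGaussian 0 K).withDensity fun x ↦ ENNReal.ofReal (f x)).map
        (toEuclideanCLM (𝕜 := ℝ) M)
      = (stdGaussian _).withDensity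
        fun x ↦ ENNReal.ofReal (f (toEuclideanCLM (𝕜 := ℝ) A x) * g x) := by
  rw [map_toEuclideanCLM_withDensity hAM _ (by fun_prop),
    map_toEuclideanCLM_multivariateGaussian_zero hK, hKg,
    ← withDensity_mul _ (by fun_prop) (by fun_prop)]
  congr 1 with x
  rw [Pi.mul_apply, Function.comp_apply, ENNReal.ofReal_mul (hf0 _), mul_comm]

lemma covMat_whitened_bounds {A M K : Matrix (Fin d) (Fin d) ℝ} (hK : K.PosSemidef)
    {ε : ℝ} (hε : 0 ≤ ε) (hε1 : ε < 1) (hMA : M * A = 1) (hAK : A * Aᵀ = (1 + ε) • K)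
    {P : Measure (EuclideanSpace ℝ (Fin d))} [IsProbabilityMeasure P]
    (hPK : linftyDist P (multivariateGaussian 0 K) ≤ ENNReal.ofReal ε) :
    ((1 - ε) / (1 + ε)) • 1 ≤ M * covMat P * Mᵀ ∧ M * covMat P * Mᵀ ≤ 1 := by
  have hMK := mul_mul_transpose_eq_smul_one (by positivity) hMA hAK
  have hlow := mul_mul_transpose_le
    (le_covMat_of_linftyDist_le hε hε1 hPK IsGaussian.memLp_two_id) M
  have hup := mul_mul_transpose_le (covMat_le_of_linftyDist_le hε hPK IsGaussian.memLp_two_id) M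
  rw [covMat_multivariateGaussian 0 hK, Matrix.mul_smul, Matrix.smul_mul, hMK] at hlow hup
  rw [smul_smul, ← div_eq_mul_inv] at hlow
  rw [smul_inv_smul₀ (by positivity)] at hup
  exact ⟨hlow, hup⟩

lemma orthQuadratic_sub_of_map_toEuclideanCLM {P : Measure (EuclideanSpace ℝ (Fin d))}
    [IsProbabilityMeasure P] (hP : MemLp id 2 P) (hP0 : ∫ x, x ∂P = 0)
    (M : Matrix (Fin d) (Fin d) ℝ) {η : ℝ} (hη : 0 < η) {F G : EuclideanSpace ℝ (Fin d) → ℝ}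
    (hF : IsPinched η F) (hG : IsPinched η G)
    (hPF : P.map (toEuclideanCLM (𝕜 := ℝ) M)
      = (stdGaussian _).withDensity fun x ↦ ENNReal.ofReal (F x))
    (hPG : (multivariateGaussian 0 (covMat P)).map (toEuclideanCLM (𝕜 := ℝ) M)
      = (stdGaussian _).withDensity fun x ↦ ENNReal.ofReal (G x)) :
    OrthQuadratic (fun x ↦ F x - G x) := by
  have := Measure.isProbabilityMeasure_map (μ := P) (f := toEuclideanCLM (𝕜 := ℝ) M) (by fun_prop)
  have := Measure.isProbabilityMeasure_map (μ := multivariateGaussian 0 (covMat P))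
    (f := toEuclideanCLM (𝕜 := ℝ) M) (by fun_prop)
  have hγP : MemLp id 2 (multivariateGaussian (0 : EuclideanSpace ℝ (Fin d)) (covMat P)) :=
    IsGaussian.memLp_two_id
  refine orthQuadratic_sub_of_covMat_eq (C := 1 + η) hF.measurable hG.measurable
    (fun x ↦ ⟨(hF.pos hη x).le, hF.upper x⟩) (fun x ↦ ⟨(hG.pos hη x).le, hG.upper x⟩)
    hPF hPG (memLp_map_toEuclideanCLM hP M) (memLp_map_toEuclideanCLM hγP M) ?_ ?_
  · rw [integral_map_toEuclideanCLM (hP.integrable one_le_two), hP0,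
      integral_map_toEuclideanCLM (hγP.integrable one_le_two), integral_id_multivariateGaussian]
  · rw [covMat_map_toEuclideanCLM hP, covMat_map_toEuclideanCLM hγP,
      covMat_multivariateGaussian 0 (posSemidef_covMat hP)]

-- Whitening by `((1 + ε) K)^(-1/2)` rather than `K^(-1/2)` keeps both covariances below the
-- identity, so that the densities stay bounded.
lemma eventually_exists_isPinched_map {η : ℝ} (hη : 0 < η) :
    ∀ᶠ ε : ℝ in 𝓝[>] 0, ε < 1 → ∀ {K : Matrix (Fin d) (Fin d) ℝ}, K.PosSemidef →
      ∀ {A M : Matrix (Fin d) (Fin d) ℝ}, M * A = 1 → A * Aᵀ = (1 + ε) • K →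
      ∀ {P : Measure (EuclideanSpace ℝ (Fin d))}, IsProbabilityMeasure P →
      linftyDist P (multivariateGaussian 0 K) ≤ ENNReal.ofReal ε → ∫ x, x ∂P = 0 →
      ∃ F G, IsPinched η F ∧ IsPinched η G ∧ OrthQuadratic (fun x ↦ F x - G x) ∧
        P.map (toEuclideanCLM (𝕜 := ℝ) M)
          = (stdGaussian _).withDensity (fun x ↦ ENNReal.ofReal (F x)) ∧
        (multivariateGaussian 0 (covMat P)).map (toEuclideanCLM (𝕜 := ℝ) M)
          = (stdGaussian _).withDensity (fun x ↦ ENNReal.ofReal (G x)) := by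
  filter_upwards [eventually_exists_isPinched (ι := Fin d) hη, self_mem_nhdsWithin] with ε hpinched
    hε hε1 K hK A M hMA hAK P _ hPK hP0
  rw [Set.mem_Ioi] at hε
  have hP : MemLp id 2 P := memLp_of_linftyDist_le hε.le hPK IsGaussian.memLp_two_id
  have hMK := mul_mul_transpose_eq_smul_one (by positivity) hMA hAK
  have hlow : ((1 - ε) / (1 + ε)) • (1 : Matrix (Fin d) (Fin d) ℝ) ≤ (1 + ε)⁻¹ • 1 := by
    rw [div_eq_mul_inv]
    gcongr
    exact mul_le_of_le_one_left (by positivity) (by linarith)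
  have hup : (1 + ε)⁻¹ • (1 : Matrix (Fin d) (Fin d) ℝ) ≤ 1 := by
    calc (1 + ε)⁻¹ • (1 : Matrix (Fin d) (Fin d) ℝ) ≤ (1 : ℝ) • 1 := by
          gcongr
          exact inv_le_one_of_one_le₀ (by linarith)
      _ = 1 := one_smul _ _
  obtain ⟨f, hf, hfb, hPf⟩ := exists_density_of_linftyDist_le hε.le hPK
  obtain ⟨g, hg, hKg, hF⟩ := hpinched ((1 + ε)⁻¹ • 1) hlow hup
  obtain ⟨hPlow, hPup⟩ := covMat_whitened_bounds hK hε.le hε1 hMA hAK hPK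
  obtain ⟨G, -, hPG, hG⟩ := hpinched _ hPlow hPup
  replace hF := hF (fun x ↦ f (toEuclideanCLM (𝕜 := ℝ) A x)) (by fun_prop) fun x ↦ hfb _
  replace hG : IsPinched η G := by
    simpa using hG (fun _ ↦ 1) measurable_const fun _ ↦ ⟨by linarith, by linarith⟩
  have hPM := map_toEuclideanCLM_withDensity_multivariateGaussian (mul_eq_one_comm.1 hMA) hK hf
    (fun x ↦ (sub_nonneg.2 hε1.le).trans (hfb x).1) hg (hMK ▸ hKg)
  rw [← hPf] at hPM
  rw [← map_toEuclideanCLM_multivariateGaussian_zero (posSemidef_covMat hP)] at hPG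
  exact ⟨_, G, hF, hG, orthQuadratic_sub_of_map_toEuclideanCLM hP hP0 M hη hF hG hPM hPG, hPM, hPG⟩

lemma exists_klDiv_conv_le {u k : ℝ} (hu : 0 < u) {K : Matrix (Fin d) (Fin d) ℝ} (hK : K.PosDef)
    (hk : 0 < k) (hKk : K ≤ k • 1) (h : k < u / ((1 + u) ^ (1 / 3 : ℝ) - 1)) :
    ∃ ε : ℝ, 0 < ε ∧ ε < 1 ∧ ∀ P : Measure (EuclideanSpace ℝ (Fin d)), IsProbabilityMeasure P →
      linftyDist P (multivariateGaussian 0 K) ≤ ENNReal.ofReal ε → ∫ x, x ∂P = 0 →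
        ENNReal.ofReal (1 + u) * klDiv (P ∗ multivariateGaussian 0 (u • 1))
            (multivariateGaussian 0 (covMat P) ∗ multivariateGaussian 0 (u • 1))
          ≤ klDiv P (multivariateGaussian 0 (covMat P)) := by
  obtain ⟨ρ, hρ0, hρ1, hρk, hρu⟩ := exists_ouScale hu hk h
  obtain ⟨η, hη, hcontract⟩ := exists_klDiv_ouMeasure_le (EuclideanSpace ℝ (Fin d)) hρ0 hρ1
    (κ := 1 + u) (by linarith) hρu
  have hscale : ∀ᶠ ε : ℝ in 𝓝 0, (1 - ρ ^ 2) / ρ ^ 2 * ((1 + ε) * k) < u :=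
    (by fun_prop : Continuous fun ε : ℝ ↦ (1 - ρ ^ 2) / ρ ^ 2 * ((1 + ε) * k)).continuousAt
      |>.eventually_lt_const (by simpa using hρk)
  obtain ⟨ε, ⟨hwhite, hεu, hε1⟩, hε0 : 0 < ε⟩ := ((eventually_exists_isPinched_map (d := d) hη).and
    ((hscale.and (eventually_lt_nhds one_pos)).filter_mono nhdsWithin_le_nhds)
      |>.and self_mem_nhdsWithin).exists
  obtain ⟨A, M, hMA, hAK⟩ := exists_mul_eq_one_and_mul_transpose_eq
    (hK.smul (by positivity : 0 < 1 + ε))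
  have hρ := one_sub_sq_nonneg hρ0.le hρ1.le
  have hA : ((1 - ρ ^ 2) / ρ ^ 2) • (A * Aᵀ) ≤ u • 1 := by
    calc ((1 - ρ ^ 2) / ρ ^ 2) • (A * Aᵀ) ≤ ((1 - ρ ^ 2) / ρ ^ 2) • (1 + ε) • k • 1 := by
          rw [hAK]
          gcongr
      _ ≤ u • 1 := by
          rw [smul_smul, smul_smul, mul_assoc]
          gcongr
  refine ⟨ε, hε0, hε1, fun P hP hPK hP0 ↦ ?_⟩
  obtain ⟨F, G, hF, hG, horth, hPF, hPG⟩ := hwhite hε1 hK.posSemidef hMA hAK hP hPK hP0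
  refine mul_klDiv_conv_multivariateGaussian_le hρ0 hρ1.le (mul_eq_one_comm.1 hMA) hA ?_
  rw [hPF, hPG]
  exact hcontract F G hF hG horth

end Stability

section Functionals

open Matrix WithLp InformationTheory Filter
open scoped MatrixOrder Topology

variable {d : ℕ}

lemma absolutelyContinuous_multivariateGaussian {S : Matrix (Fin d) (Fin d) ℝ} (hS : S.PosDef) :
    multivariateGaussian 0 S ≪ volume := by
  rw [multivariateGaussian_eq_withDensity 0 hS]
  exact withDensity_absolutelyContinuous _ _

lemma ae_inner_eq_zero_multivariateGaussian {K : Matrix (Fin d) (Fin d) ℝ} (hK : K.PosSemidef)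
    {v : EuclideanSpace ℝ (Fin d)} (hKv : K *ᵥ ofLp v = 0) :
    ∀ᵐ x ∂(multivariateGaussian 0 K), inner ℝ v x = 0 := by
  have hγ : MemLp id 2 (multivariateGaussian (0 : EuclideanSpace ℝ (Fin d)) K) :=
    IsGaussian.memLp_two_id
  have hvx : MemLp (fun x ↦ inner ℝ v x) 2
      (multivariateGaussian (0 : EuclideanSpace ℝ (Fin d)) K) := hγ.const_inner v
  have hsq := integral_inner_sq hγ v
  rw [covMat_multivariateGaussian 0 hK, integral_id_multivariateGaussian, hKv, dotProduct_zero,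
    inner_zero_right, zero_pow two_ne_zero, add_zero,
    integral_eq_zero_iff_of_nonneg (fun x ↦ sq_nonneg _) hvx.integrable_sq] at hsq
  filter_upwards [hsq] with x hx using pow_eq_zero_iff two_ne_zero |>.1 hx

lemma multivariateGaussian_mutuallySingular_volume {K : Matrix (Fin d) (Fin d) ℝ}
    (hK : K.PosSemidef) (hK' : ¬ K.PosDef) :
    multivariateGaussian (0 : EuclideanSpace ℝ (Fin d)) K ⟂ₘ volume := by
  obtain ⟨v, hv, hKv⟩ : ∃ v, v ≠ 0 ∧ K *ᵥ v = 0 := by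
    rw [exists_mulVec_eq_zero_iff]
    by_contra hdet
    exact hK' (hK.posDef_iff_isUnit.2 ((isUnit_iff_isUnit_det K).2 (Ne.isUnit hdet)))
  have hspan : (ℝ ∙ toLp 2 v)ᗮ ≠ ⊤ := by
    simpa [Submodule.orthogonal_eq_top_iff] using hv
  refine Measure.MutuallySingular.symm
    ⟨(ℝ ∙ toLp 2 v)ᗮ, Submodule.closed_of_finiteDimensional _ |>.measurableSet,
      Measure.addHaar_submodule volume _ hspan, ?_⟩
  rw [← mem_ae_iff]
  filter_upwards [ae_inner_eq_zero_multivariateGaussian hK (v := toLp 2 v) hKv] with x hx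
  exact Submodule.mem_orthogonal_singleton_iff_inner_right.2 hx

lemma posDef_smul_one {u : ℝ} (hu : 0 < u) :
    (u • (1 : Matrix (Fin d) (Fin d) ℝ)).PosDef := PosDef.one.smul hu

lemma Psi_le_Theta {u : ℝ} (hu : 0 < u) (L : Matrix (Fin d) (Fin d) ℝ)
    {P : Measure (EuclideanSpace ℝ (Fin d))} [IsProbabilityMeasure P] (hP : MemLp id 2 P) :
    Psi u P L ≤ Theta u P L := by
  have huI := posDef_smul_one (d := d) hu
  have hγ : MemLp id 2 (multivariateGaussian (0 : EuclideanSpace ℝ (Fin d)) (u • 1)) :=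
    IsGaussian.memLp_two_id
  unfold Psi Theta gaussianIso gaussianCov
  refine iSup₂_le fun Q ⟨_, hQ, hLQ⟩ ↦ ?_
  have hcov : covMat ((P ∗ multivariateGaussian 0 (u • 1)) ∗ Q) = covMat P + u • 1 + covMat Q := by
    rw [covMat_conv (memLp_id_conv hP hγ) hQ, covMat_conv hP hγ,
      covMat_multivariateGaussian 0 huI.posSemidef]
  have hpd : (covMat P + u • 1 + covMat Q).PosDef :=
    (huI.posSemidef_add (posSemidef_covMat hP)).add_posSemidef (posSemidef_covMat hQ)
  have hdet : (covMat P + u • 1 + covMat Q).det ≤ (covMat P + u • 1 + L).det :=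
    det_le_det hpd (add_le_add_right (le_iff.2 hLQ) _)
  have hentropy := diffEntropy_le (memLp_id_conv (memLp_id_conv hP hγ) hQ) (by rwa [hcov])
  rw [hcov] at hentropy
  refine EReal.sub_le_sub (add_le_add_left ?_ _) le_rfl
  refine (mul_le_mul_of_nonneg_left hentropy (EReal.coe_nonneg.2 hu.le)).trans ?_
  have := hpd.det_pos
  rw [← EReal.coe_mul, EReal.coe_le_coe_iff, ← mul_assoc, mul_one_div]
  gcongr

lemma diffEntropy_of_not_absolutelyContinuous {P : Measure (EuclideanSpace ℝ (Fin d))}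
    (hP : ¬ P ≪ volume) : diffEntropy P = ⊥ := by
  rw [diffEntropy, if_neg hP]

lemma Theta_of_not_absolutelyContinuous (u : ℝ) (L : Matrix (Fin d) (Fin d) ℝ)
    {P : Measure (EuclideanSpace ℝ (Fin d))} (hP : ¬ P ≪ volume) : Theta u P L = ⊥ := by
  rw [Theta, diffEntropy_of_not_absolutelyContinuous hP, EReal.add_bot, EReal.bot_sub]

lemma Psi_of_not_absolutelyContinuous (u : ℝ) (L : Matrix (Fin d) (Fin d) ℝ)
    {P : Measure (EuclideanSpace ℝ (Fin d))} (hP : ¬ P ≪ volume) : Psi u P L = ⊥ := by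
  simp only [Psi, diffEntropy_of_not_absolutelyContinuous hP, EReal.add_bot, EReal.bot_sub,
    iSup_bot]

lemma diffEntropy_multivariateGaussian {S : Matrix (Fin d) (Fin d) ℝ} (hS : S.PosDef) :
    diffEntropy (multivariateGaussian 0 S)
      = ((1 / 2 * Real.log ((2 * Real.pi * Real.exp 1) ^ d * S.det) : ℝ) : EReal) := by
  have hcov := covMat_multivariateGaussian 0 hS.posSemidef
  rw [diffEntropy_eq_sub_klDiv (absolutelyContinuous_multivariateGaussian hS)
    IsGaussian.memLp_two_id (by rwa [hcov]), hcov, integral_id_multivariateGaussian, klDiv_self]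
  simp

lemma add_sub_sub_mul_sub_le {κ : ℝ} (hκ : 0 < κ) (c h₀ h₁ : ℝ) {D₀ D₁ : ℝ≥0∞}
    (h : ENNReal.ofReal κ * D₁ ≤ D₀) :
    (c : EReal) + (h₀ - D₀) - (κ : EReal) * (h₁ - D₁)
      ≤ c + h₀ - (κ : EReal) * h₁ := by
  by_cases hD₀ : D₀ = ⊤
  · rw [hD₀, EReal.coe_ennreal_top, EReal.sub_top, EReal.add_bot, EReal.bot_sub]
    exact bot_le
  have hD₁ : D₁ ≠ ⊤ := by
    rintro rfl
    rw [ENNReal.mul_top (by simpa using hκ)] at h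
    exact hD₀ (top_le_iff.1 h)
  have hle := ENNReal.toReal_mono hD₀ h
  rw [ENNReal.toReal_mul, ENNReal.toReal_ofReal hκ.le] at hle
  rw [← EReal.coe_ennreal_toReal hD₀, ← EReal.coe_ennreal_toReal hD₁]
  norm_cast
  linarith

lemma Theta_le_Theta_gaussianCov {u : ℝ} (hu : 0 < u) (L : Matrix (Fin d) (Fin d) ℝ)
    {P : Measure (EuclideanSpace ℝ (Fin d))} [IsProbabilityMeasure P] (hac : P ≪ volume)
    (hmean : ∫ x, x ∂P = 0) (hP : MemLp id 2 P) (hcov : (covMat P).PosDef)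
    (h : ENNReal.ofReal (1 + u) * klDiv (P ∗ multivariateGaussian 0 (u • 1))
        (multivariateGaussian 0 (covMat P) ∗ multivariateGaussian 0 (u • 1))
      ≤ klDiv P (multivariateGaussian 0 (covMat P))) :
    Theta u P L ≤ Theta u (gaussianCov (covMat P)) L := by
  have huI := posDef_smul_one (d := d) hu
  have hγ : MemLp id 2 (multivariateGaussian (0 : EuclideanSpace ℝ (Fin d)) (u • 1)) :=
    IsGaussian.memLp_two_id
  have hconv : multivariateGaussian 0 (covMat P) ∗ multivariateGaussian 0 (u • 1)
      = multivariateGaussian 0 (covMat P + u • 1) := by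
    rw [multivariateGaussian_conv_multivariateGaussian hcov.posSemidef huI.posSemidef, add_zero]
  have hcovγ : covMat (P ∗ multivariateGaussian 0 (u • 1)) = covMat P + u • 1 := by
    rw [covMat_conv hP hγ, covMat_multivariateGaussian 0 huI.posSemidef]
  have hmeanγ : ∫ x, x ∂(P ∗ multivariateGaussian 0 (u • 1)) = 0 := by
    rw [integral_id_conv (hP.integrable one_le_two) (hγ.integrable one_le_two), hmean,
      integral_id_multivariateGaussian, add_zero]
  have hacγ : P ∗ multivariateGaussian 0 (u • 1) ≪ volume :=
    Measure.conv_absolutelyContinuous (absolutelyContinuous_multivariateGaussian huI)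
  have hent := diffEntropy_eq_sub_klDiv hac hP hcov
  have hentγ := diffEntropy_eq_sub_klDiv hacγ (memLp_id_conv hP hγ) (hcovγ ▸ hcov.add huI)
  rw [hmean] at hent
  rw [hmeanγ, hcovγ] at hentγ
  rw [hconv] at h
  simp only [Theta, gaussianIso, gaussianCov]
  rw [hconv, covMat_multivariateGaussian 0 hcov.posSemidef, diffEntropy_multivariateGaussian hcov,
    diffEntropy_multivariateGaussian (hcov.add huI), hent, hentγ]
  exact add_sub_sub_mul_sub_le (by linarith) _ _ _ h

lemma exists_pos_le_smul_one_of_eigenvalues_lt {ι : Type*} [Fintype ι] [DecidableEq ι]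
    {K : Matrix ι ι ℝ} (hK : K.IsHermitian) {b : ℝ} (hb : 0 < b) (h : ∀ i, hK.eigenvalues i < b) :
    ∃ k, 0 < k ∧ k < b ∧ K ≤ k • 1 := by
  have hlt : ∀ᶠ k in 𝓝[<] b, ∀ i, hK.eigenvalues i < k :=
    (eventually_all.2 fun i ↦ eventually_gt_nhds (h i)).filter_mono nhdsWithin_le_nhds
  obtain ⟨k, hKk, hk0, hkb : k < b⟩ := (hlt.and (((eventually_gt_nhds hb).filter_mono
    nhdsWithin_le_nhds).and self_mem_nhdsWithin)).exists
  refine ⟨k, hk0, hkb, ?_⟩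
  rw [← Algebra.algebraMap_eq_smul_one, le_algebraMap_iff_spectrum_le hK.isSelfAdjoint]
  intro x hx
  rw [hK.spectrum_real_eq_range_eigenvalues] at hx
  obtain ⟨i, rfl⟩ := hx
  exact (hKk i).le

end Functionals

theorem theorem5_general {d : ℕ} {u : ℝ} (hu : 0 < u)
    (K : Matrix (Fin d) (Fin d) ℝ) (hK : K.PosSemidef)
    (htop : ∀ i, hK.isHermitian.eigenvalues i < u / ((1 + u) ^ (1 / 3 : ℝ) - 1)) :
    ∃ ε : ℝ, 0 < ε ∧ ∀ P : Measure (EuclideanSpace ℝ (Fin d)), IsProbabilityMeasure P →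
      linftyDist P (gaussianCov K) ≤ ENNReal.ofReal ε → ∫ x, x ∂P = 0 →
        ∀ L : Matrix (Fin d) (Fin d) ℝ, L.PosSemidef →
          Theta u P L ≤ Phi u L ∧ Psi u P L ≤ Phi u L := by
  unfold gaussianCov
  by_cases hKpos : K.PosDef
  · have hbound : 0 < u / ((1 + u) ^ (1 / 3 : ℝ) - 1) :=
      div_pos hu (sub_pos.2 (Real.one_lt_rpow (by linarith) (by norm_num)))
    obtain ⟨k, hk0, hk, hKk⟩ := exists_pos_le_smul_one_of_eigenvalues_lt hK.isHermitian hbound htop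
    obtain ⟨ε, hε0, hε1, hkl⟩ := exists_klDiv_conv_le hu hKpos hk0 hKk hk
    refine ⟨ε, hε0, fun P hP hPK hmean L _ ↦ ?_⟩
    have hac : P ≪ volume := (absolutelyContinuous_of_linftyDist_le hPK).trans
      (absolutelyContinuous_multivariateGaussian hKpos)
    have hP2 : MemLp id 2 P := memLp_of_linftyDist_le hε0.le hPK IsGaussian.memLp_two_id
    have hcov := posDef_covMat_of_linftyDist_le hKpos hε0.le hε1 hPK
    have hTheta : Theta u P L ≤ Phi u L :=
      (Theta_le_Theta_gaussianCov hu L hac hmean hP2 hcov (hkl P hP hPK hmean)).trans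
        (le_iSup₂_of_le (covMat P) hcov.posSemidef le_rfl)
    exact ⟨hTheta, (Psi_le_Theta hu L hP2).trans hTheta⟩
  · refine ⟨1, one_pos, fun P _ hPK _ L _ ↦ ?_⟩
    have hac : ¬ P ≪ volume := fun hac ↦ IsProbabilityMeasure.ne_zero P <|
      Measure.MutuallySingular.self_iff P |>.1 <|
        (multivariateGaussian_mutuallySingular_volume hK hKpos).mono_ac
          (absolutelyContinuous_of_linftyDist_le hPK) hac
    rw [Theta_of_not_absolutelyContinuous u L hac, Psi_of_not_absolutelyContinuous u L hac]
    exact ⟨bot_le, bot_le⟩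

theorem theorem5 {d : ℕ} (hd : 0 < d) {u : ℝ} (hu : 0 < u)
    (L : Matrix (Fin d) (Fin d) ℝ) (hL : L.PosSemidef)
    (K : Matrix (Fin d) (Fin d) ℝ) (hK : K.PosSemidef)
    (hmax : IsMaxOn (fun K' : Matrix (Fin d) (Fin d) ℝ => Theta u (gaussianCov K') L)
      {K' | K'.PosSemidef} K)
    (htop : ∀ i, hK.isHermitian.eigenvalues i < u / ((1 + u) ^ (1 / 3 : ℝ) - 1)) :
    ∃ ε : ℝ, 0 < ε ∧ ∀ P : Measure (EuclideanSpace ℝ (Fin d)), IsProbabilityMeasure P →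
      linftyDist P (gaussianCov K) ≤ ENNReal.ofReal ε → ∫ x, x ∂P = 0 →
        Theta u P L ≤ Phi u L ∧ Psi u P L ≤ Phi u L := by
  obtain ⟨ε, hε, h⟩ := theorem5_general hu K hK htop
  exact ⟨ε, hε, fun P hP hPK hmean ↦ h P hP hPK hmean L hL⟩
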